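/- Let $d\in\{2,3\}$ and let $\Omega\subset\mathbb R^d$ be a bounded Lipschitz open set with outward unit normal $\boldsymbol n$. Fix constants $\rho_1,\rho_2,\mu_1,\mu_2,\lambda,\eta,m,\Delta t>0$, $S\ge 0$, $\nu_m,C_0\in\mathbb R$, and put $\rho_0=\min(\rho_1,\rho_2)$, $\rho(\phi)=\frac{\rho_1+\rho_2}2+\frac{\rho_1-\rho_2}2\phi$, $\mu(\phi)=\frac{\mu_1+\mu_2}2+\frac{\mu_1-\mu_2}2\phi$, $F(\phi)=\frac{\lambda}{4\eta^2}(1-\phi^2)^2$, $h=F'$, $\tilde{\boldsymbol J}(\phi)=-\frac12(\rho_1-\rho_2)\,m\nabla\big(-\lambda\nabla^2\phi+h(\phi)\big)$, $\mathcal D(\boldsymbol u)=\nabla\boldsymbol u+(\nabla\boldsymbol u)^T$. Let $J\in\{1,2\}$. For a time-level sequence $\chi^n$ set, for $J=1$, $\gamma_0=1$, $\hat\chi=\chi^n$, $\chi^{*,n+1}=\chi^n$, and, for $J=2$, $\gamma_0=\frac32$, $\hat\chi=2\chi^n-\frac12\chi^{n-1}$, $\chi^{*,n+1}=2\chi^n-\chi^{n-1}$;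 write $\delta\chi=\frac{\gamma_0\chi^{n+1}-\hat\chi}{\Delta t}$. Let $n\ge J-1$. Given the previous levels, the velocity, pressure, phase field and scalar variable $(\boldsymbol u^{n+1},P^{n+1},\phi^{n+1},R^{n+1})$ solve the following step of the scheme, where $\bar\phi^{n+1}$ is any approximation of $\phi^{n+1}$, $\bar\rho=\rho(\bar\phi^{n+1})$, $\bar\mu=\bar\mu^{n+1}=\mu(\bar\phi^{n+1})$: $$\xi=\frac{R^{n+1}}{\sqrt{E^{n+1}}},\qquad E^{n+1}=\int_\Omega\Big[\tfrac12\bar\rho|\boldsymbol u^{n+1}|^2+F(\phi^{n+1})\Big]+C_0,$$ $$\bar\rho\,\delta\boldsymbol u+\xi\bar\rho\,\boldsymbol{\mathcal N}=-\frac{\bar\rho}{\rho_0}\nabla P^{n+1}+\nu_m\bar\rho\nabla^2\boldsymbol u^{n+1}+\mathcal C^{n+1}\nabla\bar\phi^{n+1}+\boldsymbol f^{n+1},\qquad \nabla\cdot\boldsymbol u^{n+1}=0,$$ $$\delta\phi+\xi\,\boldsymbol u^{*,n+1}\cdot\nabla\phi^{*,n+1}=m\nabla^2\mathcal C^{n+1}+g^{n+1},\qquad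 \mathcal C^{n+1}=-\lambda\nabla^2\phi^{n+1}+S(\phi^{n+1}-\phi^{*,n+1})+\xi h(\phi^{*,n+1}),$$ $$\begin{aligned}2R^{n+1}\,\delta R={}&\int_\Omega\bar\rho\,\delta\boldsymbol u\cdot\boldsymbol u^{n+1}-\int_\Omega\mathcal C^{n+1}\boldsymbol u^{n+1}\cdot\nabla\bar\phi^{n+1}+\xi\int_\Omega\mathcal C^{n+1}\boldsymbol u^{*,n+1}\cdot\nabla\phi^{*,n+1}+\xi\int_\Omega h(\phi^{*,n+1})\,\delta\phi+\xi\int_\Omega\bar\rho\,\boldsymbol{\mathcal N}\cdot\boldsymbol u^{n+1}\\&+\int_\Omega\Big\{\nabla\bar\mu\cdot\mathcal D(\boldsymbol u^{n+1})+\Big(\frac{\bar\rho}{\rho_0}-1\Big)\nabla P^{n+1}+(\bar\mu-\nu_m\bar\rho)\nabla^2\boldsymbol u^{n+1}\Big\}\cdot\boldsymbol u^{n+1}\\&-\frac12\int_{\partial\Omega}(\boldsymbol n\cdot\boldsymbol u^{n+1})\bar\rho|\boldsymbol u^{n+1}|^2-\frac12\int_{\partial\Omega}\big(\boldsymbol n\cdot\tilde{\boldsymbol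 J}(\phi^{n+1})\big)|\boldsymbol u^{n+1}|^2,\end{aligned}$$ $$\boldsymbol{\mathcal N}=\boldsymbol u^{*,n+1}\cdot\nabla\boldsymbol u^{*,n+1}+\frac1{\bar\rho}\tilde{\boldsymbol J}(\bar\phi^{n+1})\cdot\nabla\boldsymbol u^{*,n+1}-\frac1{\bar\rho}\nabla\bar\mu\cdot\mathcal D(\boldsymbol u^{*,n+1})+\Big(\frac1{\bar\rho}-\frac1{\rho_0}\Big)\nabla P^{*,n+1}+\Big(\frac{\bar\mu}{\bar\rho}-\nu_m\Big)\nabla\times\nabla\times\boldsymbol u^{*,n+1},$$ and, on $\partial\Omega$, $\boldsymbol u^{n+1}=\boldsymbol w^{n+1}$, $\boldsymbol n\cdot\nabla\phi^{n+1}=d_a^{n+1}$, $\boldsymbol n\cdot\nabla(\nabla^2\phi^{n+1})=d_b^{n+1}$. At every level $k$ entering the step ($n+1-J\le k\le n+1$), $\phi^k\in C^4(\overline\Omega)$, $\boldsymbol u^k\in C^2(\overline\Omega)^d$, $P^k\in C^1(\overline\Omega)$, and also $\bar\phi^{n+1}\in C^3(\overline\Omega)$. Suppose $\boldsymbol f^{n+1}=\boldsymbol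 0$, $g^{n+1}=0$, $\boldsymbol w^{n+1}=\boldsymbol 0$, $d_b^{n+1}=0$, and that at every level $k$ entering the step the condition $\boldsymbol n\cdot\nabla\phi^k=d_a^k$ holds on $\partial\Omega$ with $d_a^k=0$. Then $$\mathcal E^{n+1}-\mathcal E^n=-D^{n+1}-\frac12\int_\Omega\bar\mu^{n+1}\|\mathcal D(\boldsymbol u^{n+1})\|^2-\int_\Omega m|\nabla\mathcal C^{n+1}|^2,$$ where (with $\|\cdot\|$ the $L^2(\Omega)$ norm of fields, and the pointwise Frobenius norm of $\mathcal D$) $$\mathcal E^n=\begin{cases}\frac{\lambda}{2\Delta t}\|\nabla\phi^n\|^2+\frac1{\Delta t}|R^n|^2,&J=1,\\[2pt]\frac S{2\Delta t}\|\phi^n-\phi^{n-1}\|^2+\frac\lambda{4\Delta t}\big(\|\nabla\phi^n\|^2+\|\nabla(2\phi^n-\phi^{n-1})\|^2\big)+\frac1{2\Delta t}\big(|R^n|^2+|2R^n-R^{n-1}|^2\big),&J=2,\end{cases}$$ $$D^{n+1}=\begin{cases}\frac S{\Delta t}\|\phi^{n+1}-\phi^n\|^2+\frac\lambda{2\Delta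 t}\|\nabla\phi^{n+1}-\nabla\phi^n\|^2+\frac1{\Delta t}|R^{n+1}-R^n|^2,&J=1,\\[2pt]\frac S{\Delta t}\|\phi^{n+1}-\phi^{*,n+1}\|^2+\frac\lambda{4\Delta t}\|\nabla\phi^{n+1}-\nabla\phi^{*,n+1}\|^2+\frac1{2\Delta t}|R^{n+1}-R^{*,n+1}|^2,&J=2.\end{cases}$$ Moreover $D^{n+1}\ge 0$, and consequently $\mathcal E^{n+1}\le\mathcal E^n$ for every $\Delta t>0$ whenever $\bar\mu^{n+1}\ge 0$ in $\Omega$. -/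

import Mathlib

open MeasureTheory Set Filter Topology
open scoped NNReal

noncomputable section

namespace TwoPhase

/-! ### Domains and differential operators -/

/-- Points (and vectors) of `ℝ^d` with the Euclidean norm. -/
abbrev Space (d : ℕ) : Type := EuclideanSpace ℝ (Fin d)

/-- A bounded Lipschitz open set: near each boundary point, `Ω` is the region strictly below the
graph of a Lipschitz function, where "height" is measured along some unit vector `ν` and the
function is evaluated at the orthogonal projection of the point onto the hyperplane `ν^⊥`. -/
structure IsBoundedLipschitzDomain {d : ℕ} (Ω : Set (Space d)) : Prop where
  isOpen : IsOpen Ω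
  isBounded : Bornology.IsBounded Ω
  graph : ∀ x ∈ frontier Ω, ∃ ν : Space d, ‖ν‖ = 1 ∧
    ∃ (K : ℝ≥0) (γ : Space d → ℝ), LipschitzWith K γ ∧
      ∀ᶠ y in 𝓝 x, (y ∈ Ω ↔ inner ℝ ν y < γ (y - inner ℝ ν y • ν))

/-- `N` is the outward unit normal of `Ω` at `x`: at `x` the set `Ω` is tangent, to first order,
to the half-space `{y | ⟪N, y - x⟫ < 0}`. -/
def IsOuterUnitNormal {d : ℕ} (Ω : Set (Space d)) (x N : Space d) : Prop :=
  ‖N‖ = 1 ∧ ∀ ε : ℝ, 0 < ε → ∀ᶠ y in 𝓝 x,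
    (inner ℝ N (y - x) < -(ε * ‖y - x‖) → y ∈ Ω) ∧
    (ε * ‖y - x‖ < inner ℝ N (y - x) → y ∉ Ω)

open Classical in
/-- The outward unit normal as a function (zero at the points without a normal). -/
def outerNormal {d : ℕ} (Ω : Set (Space d)) (x : Space d) : Space d :=
  if h : ∃ N, IsOuterUnitNormal Ω x N then h.choose else 0

/-- The surface integral over `∂Ω`: the `(d-1)`-dimensional Hausdorff measure,
normalised so that it agrees with Lebesgue measure on hyperplanes. -/
def surfaceIntegral {d : ℕ} (Ω : Set (Space d)) (F : Space d → ℝ) : ℝ :=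
  ∫ x in frontier Ω, F x ∂(Measure.euclideanHausdorffMeasure (d - 1))

/-- The partial derivative `∂_i f` of a function on the closure of `Ω` (one-sided at `∂Ω`, the
usual one in the open set `Ω`). -/
def pd {d : ℕ} (Ω : Set (Space d)) (i : Fin d) (f : Space d → ℝ) (x : Space d) : ℝ :=
  fderivWithin ℝ f (closure Ω) x (EuclideanSpace.single i 1)

/-- `∇ f`. -/
def grad {d : ℕ} (Ω : Set (Space d)) (f : Space d → ℝ) (x : Space d) : Space d :=
  WithLp.toLp 2 fun i => pd Ω i f x

/-- `∇² f`. -/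
def lap {d : ℕ} (Ω : Set (Space d)) (f : Space d → ℝ) (x : Space d) : ℝ :=
  ∑ i, pd Ω i (pd Ω i f) x

/-- `∇ · v`. -/
def divg {d : ℕ} (Ω : Set (Space d)) (v : Space d → Space d) (x : Space d) : ℝ :=
  ∑ i, pd Ω i (fun y => v y i) x

/-- `∇² v`, componentwise. -/
def vlap {d : ℕ} (Ω : Set (Space d)) (v : Space d → Space d) (x : Space d) : Space d :=
  WithLp.toLp 2 fun i => lap Ω (fun y => v y i) x

/-- `a · ∇ v`. -/
def adv {d : ℕ} (Ω : Set (Space d)) (a v : Space d → Space d) (x : Space d) : Space d :=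
  WithLp.toLp 2 fun i => ∑ j, a x j * pd Ω j (fun y => v y i) x

/-- `∇ × ∇ × v`: its `i`-th component is `∑_j ∂_j (∂_i v_j - ∂_j v_i)`. -/
def curlCurl {d : ℕ} (Ω : Set (Space d)) (v : Space d → Space d) (x : Space d) : Space d :=
  WithLp.toLp 2 fun i => ∑ j,
    pd Ω j (fun y => pd Ω i (fun z => v z j) y - pd Ω j (fun z => v z i) y) x

/-- `𝒟(v) = ∇ v + (∇ v)ᵀ`. -/
def strain {d : ℕ} (Ω : Set (Space d)) (v : Space d → Space d) (x : Space d) :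
    Matrix (Fin d) (Fin d) ℝ :=
  Matrix.of fun i j => pd Ω i (fun y => v y j) x + pd Ω j (fun y => v y i) x

/-- `‖𝒟(v)‖²`, the squared Frobenius norm. -/
def strainSq {d : ℕ} (Ω : Set (Space d)) (v : Space d → Space d) (x : Space d) : ℝ :=
  ∑ i, ∑ j, strain Ω v x i j ^ 2

/-- `∇ s · 𝒟(v)` for a scalar field `s`. -/
def gradDotStrain {d : ℕ} (Ω : Set (Space d)) (s : Space d → ℝ) (v : Space d → Space d)
    (x : Space d) : Space d :=
  WithLp.toLp 2 fun i => ∑ j, pd Ω j s x * strain Ω v x j i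

/-- The boundary condition `n · v = b` on `∂Ω` (wherever `∂Ω` has a normal). -/
def NormalTraceEq {d : ℕ} (Ω : Set (Space d)) (v : Space d → Space d) (b : Space d → ℝ) : Prop :=
  ∀ x ∈ frontier Ω, ∀ N, IsOuterUnitNormal Ω x N → inner ℝ N (v x) = b x

/-- The squared `L²(Ω)` norm of a scalar field. -/
def sqNorm {d : ℕ} (Ω : Set (Space d)) (f : Space d → ℝ) : ℝ :=
  ∫ x in Ω, f x ^ 2

/-- The squared `L²(Ω)` norm of a vector field. -/
def vsqNorm {d : ℕ} (Ω : Set (Space d)) (v : Space d → Space d) : ℝ :=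
  ∫ x in Ω, ‖v x‖ ^ 2

/-! ### Backward differentiation formulas -/

/-- The temporal order `J` of the scheme. -/
inductive BDF where
  | one
  | two

/-- `J` as a number. -/
def BDF.order : BDF → ℕ
  | .one => 1
  | .two => 2

/-- `γ₀`. -/
def BDF.gamma0 : BDF → ℝ
  | .one => 1
  | .two => 3 / 2

/-- `J.hat χ n` is the `χ̂` of the step from `n` to `n + 1`. -/
def BDF.hat {V : Type} [AddCommGroup V] [Module ℝ V] (J : BDF) (χ : ℕ → V) (n : ℕ) : V :=
  match J with
  | .one => χ n
  | .two => (2 : ℝ) • χ n - (1 / 2 : ℝ) • χ (n - 1)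

/-- `J.star χ n` is the extrapolation `χ^{*,n+1}`. -/
def BDF.star {V : Type} [AddCommGroup V] [Module ℝ V] (J : BDF) (χ : ℕ → V) (n : ℕ) : V :=
  match J with
  | .one => χ n
  | .two => (2 : ℝ) • χ n - χ (n - 1)

/-- `(γ₀ χ^{n+1} - χ̂) / Δt`. -/
def BDF.diffQuot {V : Type} [AddCommGroup V] [Module ℝ V] (J : BDF) (Δt : ℝ) (χ : ℕ → V)
    (n : ℕ) : V :=
  Δt⁻¹ • (J.gamma0 • χ (n + 1) - J.hat χ n)

/-- The time levels `n + 1, n, …, n + 1 - J` that enter the step from `n` to `n + 1`. -/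
def BDF.stencil (J : BDF) (n : ℕ) : Set ℕ :=
  {k | n + 1 ≤ k + J.order ∧ k ≤ n + 1}

/-! ### The two-phase model -/

/-- The physical and numerical constants: densities `ρ₁, ρ₂` and dynamic viscosities `μ₁, μ₂` of
the two fluids, mixing energy density coefficient `lam`, interfacial thickness `η`, mobility `m`,
the stabilisation constant `S`, the constant `νm`, the energy shift `C₀` and the time step `Δt`. -/
structure Params where
  (ρ₁ ρ₂ μ₁ μ₂ lam η m S νm C₀ Δt : ℝ)
  ρ₁_pos : 0 < ρ₁
  ρ₂_pos : 0 < ρ₂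
  μ₁_pos : 0 < μ₁
  μ₂_pos : 0 < μ₂
  lam_pos : 0 < lam
  η_pos : 0 < η
  m_pos : 0 < m
  S_nonneg : 0 ≤ S
  Δt_pos : 0 < Δt

namespace Params

variable (p : Params)

/-- `ρ₀ = min(ρ₁, ρ₂)`. -/
def ρ₀ : ℝ := min p.ρ₁ p.ρ₂

/-- The mixture density as a function of the phase field. -/
def rho (s : ℝ) : ℝ := (p.ρ₁ + p.ρ₂) / 2 + (p.ρ₁ - p.ρ₂) / 2 * s

/-- The mixture viscosity as a function of the phase field. -/
def mu (s : ℝ) : ℝ := (p.μ₁ + p.μ₂) / 2 + (p.μ₁ - p.μ₂) / 2 * s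

/-- The double-well potential `F`. -/
def F (s : ℝ) : ℝ := p.lam / (4 * p.η ^ 2) * (1 - s ^ 2) ^ 2

/-- `h = F'`. -/
def h (s : ℝ) : ℝ := p.lam / p.η ^ 2 * (s ^ 3 - s)

theorem hasDerivAt_F (s : ℝ) : HasDerivAt p.F (p.h s) s := by
  have h1 := ((((hasDerivAt_id s).pow 2).const_sub 1).pow 2).const_mul (p.lam / (4 * p.η ^ 2))
  have hη := p.η_pos.ne'
  refine h1.congr_deriv ?_
  simp only [h, id, Pi.pow_apply]
  push_cast
  field_simp
  ring

/-- The diffusive mass flux `J̃(φ) = -½ (ρ₁ - ρ₂) m ∇(-λ ∇² φ + h(φ))`. -/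
def Jtilde {d : ℕ} (Ω : Set (Space d)) (φ : Space d → ℝ) (x : Space d) : Space d :=
  (-(1 / 2) * (p.ρ₁ - p.ρ₂) * p.m) •
    grad Ω (fun y => -p.lam * lap Ω φ y + p.h (φ y)) x

end Params

/-- The data of the problem, at each time level: body force `f`, source term `g`, boundary
velocity `w`, and the Neumann data `da` (for `φ`) and `db` (for `∇² φ`). -/
structure Data (d : ℕ) where
  f : ℕ → Space d → Space d
  g : ℕ → Space d → ℝ
  w : ℕ → Space d → Space d
  da : ℕ → Space d → ℝ
  db : ℕ → Space d → ℝ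

/-- The discrete quantities, at each time level: velocity `u`, pressure `P`, phase field `φ`,
scalar auxiliary variable `R`, and the approximation `φbar` of the phase field at which the
mixture properties are evaluated. -/
structure Iterates (d : ℕ) where
  u : ℕ → Space d → Space d
  P : ℕ → Space d → ℝ
  φ : ℕ → Space d → ℝ
  φbar : ℕ → Space d → ℝ
  R : ℕ → ℝ

/-- The iterates that enter the step from `n` to `n + 1` are classical, i.e. smooth up to the
boundary to the order needed for the equations to hold pointwise. -/
structure Iterates.IsClassical {d : ℕ} (s : Iterates d) (Ω : Set (Space d)) (J : BDF) (n : ℕ) :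
    Prop where
  u : ∀ k ∈ J.stencil n, ContDiffOn ℝ 2 (s.u k) (closure Ω)
  P : ∀ k ∈ J.stencil n, ContDiffOn ℝ 1 (s.P k) (closure Ω)
  φ : ∀ k ∈ J.stencil n, ContDiffOn ℝ 4 (s.φ k) (closure Ω)
  φbar : ContDiffOn ℝ 3 (s.φbar (n + 1)) (closure Ω)

namespace Iterates

variable {d : ℕ} (s : Iterates d) (Ω : Set (Space d)) (p : Params) (J : BDF) (n : ℕ)

/-- `ρ̄^{n+1}`. -/
def rhoBar (x : Space d) : ℝ := p.rho (s.φbar (n + 1) x)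

/-- `μ̄^{n+1}`. -/
def muBar (x : Space d) : ℝ := p.mu (s.φbar (n + 1) x)

/-- The shifted energy `E^{n+1}`. -/
def E : ℝ :=
  (∫ x in Ω, (1 / 2 * s.rhoBar p n x * ‖s.u (n + 1) x‖ ^ 2 + p.F (s.φ (n + 1) x))) + p.C₀

/-- `ξ^{n+1} = R^{n+1} / √(E^{n+1})`. -/
def xi : ℝ := s.R (n + 1) / Real.sqrt (s.E Ω p n)

/-- The chemical potential `𝒞^{n+1}`. -/
def chem (x : Space d) : ℝ :=
  -p.lam * lap Ω (s.φ (n + 1)) x + p.S * (s.φ (n + 1) x - J.star s.φ n x)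
    + s.xi Ω p n * p.h (J.star s.φ n x)

/-- The nonlinear term `Q`. -/
def Q (x : Space d) : Space d :=
  adv Ω (J.star s.u n) (J.star s.u n) x
    + (1 / s.rhoBar p n x) • adv Ω (p.Jtilde Ω (s.φbar (n + 1))) (J.star s.u n) x
    - (1 / s.rhoBar p n x) • gradDotStrain Ω (s.muBar p n) (J.star s.u n) x
    + (1 / s.rhoBar p n x - 1 / p.ρ₀) • grad Ω (J.star s.P n) x

/-- The nonlinear term `𝒩`. -/
def NL (x : Space d) : Space d :=
  s.Q Ω p J n x + (s.muBar p n x / s.rhoBar p n x - p.νm) • curlCurl Ω (J.star s.u n) x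

/-- The equations and boundary conditions of the scheme that determine time level `n + 1`. -/
structure SchemeStep (D : Data d) : Prop where
  momentum : ∀ x ∈ Ω,
    s.rhoBar p n x • J.diffQuot p.Δt s.u n x
        + (s.xi Ω p n * s.rhoBar p n x) • s.NL Ω p J n x
      = -(s.rhoBar p n x / p.ρ₀) • grad Ω (s.P (n + 1)) x
        + (p.νm * s.rhoBar p n x) • vlap Ω (s.u (n + 1)) x
        + s.chem Ω p J n x • grad Ω (s.φbar (n + 1)) x
        + D.f (n + 1) x
  incompressible : ∀ x ∈ Ω, divg Ω (s.u (n + 1)) x = 0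
  phase : ∀ x ∈ Ω,
    J.diffQuot p.Δt s.φ n x + s.xi Ω p n * inner ℝ (J.star s.u n x) (grad Ω (J.star s.φ n) x)
      = p.m * lap Ω (s.chem Ω p J n) x + D.g (n + 1) x
  auxiliary :
    2 * s.R (n + 1) * J.diffQuot p.Δt s.R n
      = (∫ x in Ω, s.rhoBar p n x * inner ℝ (J.diffQuot p.Δt s.u n x) (s.u (n + 1) x))
        - (∫ x in Ω, s.chem Ω p J n x * inner ℝ (s.u (n + 1) x) (grad Ω (s.φbar (n + 1)) x))
        + s.xi Ω p n *
          (∫ x in Ω, s.chem Ω p J n x * inner ℝ (J.star s.u n x) (grad Ω (J.star s.φ n) x))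
        + s.xi Ω p n * (∫ x in Ω, p.h (J.star s.φ n x) * J.diffQuot p.Δt s.φ n x)
        + s.xi Ω p n *
          (∫ x in Ω, s.rhoBar p n x * inner ℝ (s.NL Ω p J n x) (s.u (n + 1) x))
        + (∫ x in Ω, inner ℝ
            (gradDotStrain Ω (s.muBar p n) (s.u (n + 1)) x
              + (s.rhoBar p n x / p.ρ₀ - 1) • grad Ω (s.P (n + 1)) x
              + (s.muBar p n x - p.νm * s.rhoBar p n x) • vlap Ω (s.u (n + 1)) x)
            (s.u (n + 1) x))
        - 1 / 2 * surfaceIntegral Ω (fun x =>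
            inner ℝ (outerNormal Ω x) (s.u (n + 1) x) * s.rhoBar p n x * ‖s.u (n + 1) x‖ ^ 2)
        - 1 / 2 * surfaceIntegral Ω (fun x =>
            inner ℝ (outerNormal Ω x) (p.Jtilde Ω (s.φ (n + 1)) x) * ‖s.u (n + 1) x‖ ^ 2)
  velocity_bc : ∀ x ∈ frontier Ω, s.u (n + 1) x = D.w (n + 1) x
  phase_bc : NormalTraceEq Ω (grad Ω (s.φ (n + 1))) (D.da (n + 1))
  lap_phase_bc : NormalTraceEq Ω (grad Ω (lap Ω (s.φ (n + 1)))) (D.db (n + 1))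

/-! ### Discrete energy and dissipation -/

/-- The discrete energy `ℰ^n`. -/
def discreteEnergy : ℝ :=
  match J with
  | .one => p.lam / (2 * p.Δt) * vsqNorm Ω (grad Ω (s.φ n)) + 1 / p.Δt * |s.R n| ^ 2
  | .two =>
      p.S / (2 * p.Δt) * sqNorm Ω (s.φ n - s.φ (n - 1))
        + p.lam / (4 * p.Δt) * (vsqNorm Ω (grad Ω (s.φ n))
            + vsqNorm Ω (grad Ω ((2 : ℝ) • s.φ n - s.φ (n - 1))))
        + 1 / (2 * p.Δt) * (|s.R n| ^ 2 + |2 * s.R n - s.R (n - 1)| ^ 2)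

/-- The discrete dissipation `D^{n+1}`. -/
def discreteDissipation : ℝ :=
  match J with
  | .one =>
      p.S / p.Δt * sqNorm Ω (s.φ (n + 1) - s.φ n)
        + p.lam / (2 * p.Δt) * vsqNorm Ω (grad Ω (s.φ (n + 1)) - grad Ω (s.φ n))
        + 1 / p.Δt * |s.R (n + 1) - s.R n| ^ 2
  | .two =>
      p.S / p.Δt * sqNorm Ω (s.φ (n + 1) - BDF.two.star s.φ n)
        + p.lam / (4 * p.Δt)
          * vsqNorm Ω (grad Ω (s.φ (n + 1)) - grad Ω (BDF.two.star s.φ n))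
        + 1 / (2 * p.Δt) * |s.R (n + 1) - BDF.two.star s.R n| ^ 2

end Iterates

end TwoPhase

end

/-! The energy law comes from testing the momentum equation with the new velocity and the phase
equation with the chemical potential. The auxiliary equation is built so that every term without a
sign cancels. In `momentum_balance`, the volume terms of momentum type in the auxiliary equation
collapse to the divergence of the viscous and pressure stress tested with the velocity, that is, to
minus half the viscous dissipation. In `phase_balance`, the remaining volume terms, together with
the stabilisation and gradient terms, equal minus the diffusive dissipation. The surface terms
vanish because the velocity does. Adding up leaves `2 R δR + S ∫ (φ - φ*) δφ + λ ∫ ∇φ · δ∇φ`, which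
`discreteEnergy_sub_add_dissipation` rewrites as an energy increment plus a sum of squares. In all
this `ξ` is just a number; neither its sign nor its size matters.

The analytic input is the divergence theorem on a Lipschitz domain for a `C¹` field with zero normal
trace, which needs no surface measure. In a graph chart `Ω` is `{G > 0}` with `G` Lipschitz and of
slope `-1` along `ν`. Multiplying by the cutoff of `n G` and integrating by parts leaves `n ∇G · w`
on the layer `1 < n G < 2`, whose volume is `O(1/n)`. Moving along `ν` to the boundary leaves `∇G`
unchanged and reaches a point where `∇G` is normal and hence `∇G · w = 0`. So `∇G · w` is small on
the layer by uniform continuity of `w`, and the error tends to zero. A partition of unity makes this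
global. -/

noncomputable section

namespace TwoPhase

/-! ### Graph charts of a Lipschitz domain -/

/-- Inside `ball x r` the set `Ω` is the positivity set of the Lipschitz function `G`, which
decreases at unit speed in the direction `ν`. -/
structure IsGraphChart {d : ℕ} (Ω : Set (Space d)) (x : Space d) (r : ℝ) (ν : Space d)
    (L : ℝ≥0) (G : Space d → ℝ) : Prop where
  radius_pos : 0 < r
  norm_dir : ‖ν‖ = 1
  lipschitz : LipschitzWith L G
  add_smul : ∀ y t, G (y + t • ν) = G y - t
  mem_iff : ∀ y ∈ Metric.ball x r, (y ∈ Ω ↔ 0 < G y)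

theorem isGraphChart_of_graph {d : ℕ} {Ω : Set (Space d)} {x ν : Space d} (hν : ‖ν‖ = 1)
    {K : ℝ≥0} {γ : Space d → ℝ} (hγ : LipschitzWith K γ)
    (h : ∀ᶠ y in 𝓝 x, (y ∈ Ω ↔ inner ℝ ν y < γ (y - inner ℝ ν y • ν))) :
    ∃ r L G, IsGraphChart Ω x r ν L G := by
  obtain ⟨r, hr, hb⟩ := Metric.eventually_nhds_iff_ball.1 h
  -- `G` is the signed height of the graph above `y`. The constant uses the crude bound 2 for the
  -- Lipschitz constant of the projection onto `ν^⊥`.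
  refine ⟨r, K * 2 + 1, fun y => γ (y - inner ℝ ν y • ν) - inner ℝ ν y, hr, hν, ?_, ?_, ?_⟩
  · have h1 : LipschitzWith 1 (fun y : Space d => inner ℝ ν y) := by
      refine LipschitzWith.of_dist_le_mul fun a b => ?_
      rw [dist_eq_norm, dist_eq_norm, ← inner_sub_right]
      simpa [hν] using norm_inner_le_norm (𝕜 := ℝ) ν (a - b)
    have h2 : LipschitzWith 2 (fun y : Space d => y - inner ℝ ν y • ν) := by
      refine LipschitzWith.of_dist_le_mul fun a b => ?_
      have h3 := h1.dist_le_mul a b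
      rw [dist_eq_norm, dist_eq_norm, ← inner_sub_right] at h3
      rw [dist_eq_norm, dist_eq_norm]
      have : a - inner ℝ ν a • ν - (b - inner ℝ ν b • ν)
          = (a - b) - inner ℝ ν (a - b) • ν := by
        rw [inner_sub_right, sub_smul]; abel
      rw [this]
      refine (norm_sub_le _ _).trans ?_
      rw [norm_smul, hν]
      push_cast at h3 ⊢
      linarith
    exact (hγ.comp h2).sub h1
  · intro y t
    have h1 : inner ℝ ν (y + t • ν) = inner ℝ ν y + t := by
      rw [inner_add_right, real_inner_smul_right, real_inner_self_eq_norm_sq, hν]; ring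
    have h2 : y + t • ν - (inner ℝ ν y + t) • ν = y - inner ℝ ν y • ν := by
      rw [_root_.add_smul]; abel
    simp only [h1, h2]
    ring
  · intro y hy
    rw [hb y hy, sub_pos]

theorem IsBoundedLipschitzDomain.exists_chart {d : ℕ} [NeZero d] {Ω : Set (Space d)}
    (hΩ : IsBoundedLipschitzDomain Ω) {x : Space d} (hx : x ∈ closure Ω) :
    ∃ r ν L G, IsGraphChart Ω x r ν L G := by
  by_cases hxΩ : x ∈ Ω
  · let ν : Space d := EuclideanSpace.single 0 1
    have hν : ‖ν‖ = 1 := by simp [ν]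
    -- At an interior point the graph is a hyperplane one unit above `x`, so both sides of the
    -- equivalence hold near `x`.
    obtain ⟨r, L, G, h⟩ := isGraphChart_of_graph (Ω := Ω) (x := x) hν
      (LipschitzWith.const (inner ℝ ν x + 1)) (by
        have h1 : ∀ᶠ y in 𝓝 x, inner ℝ ν y < inner ℝ ν x + 1 :=
          (Continuous.inner continuous_const continuous_id).continuousAt.eventually_lt
            continuousAt_const (by simp)
        filter_upwards [hΩ.isOpen.mem_nhds hxΩ, h1] with y hy hy'
        simp [hy, hy'])
    exact ⟨r, ν, L, G, h⟩
  · have hf : x ∈ frontier Ω := by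
      rw [hΩ.isOpen.frontier_eq]; exact ⟨hx, hxΩ⟩
    obtain ⟨ν, hν, K, γ, hγ, h⟩ := hΩ.graph x hf
    obtain ⟨r, L, G, h⟩ := isGraphChart_of_graph hν hγ h
    exact ⟨r, ν, L, G, h⟩

namespace IsGraphChart

variable {d : ℕ} {Ω : Set (Space d)} {x : Space d} {r : ℝ} {ν : Space d} {L : ℝ≥0}
  {G : Space d → ℝ}

theorem nonneg_of_mem_closure (hc : IsGraphChart Ω x r ν L G) {y : Space d}
    (hy : y ∈ Metric.ball x r) (hyΩ : y ∈ closure Ω) : 0 ≤ G y := by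
  by_contra! hneg
  have h1 : ∀ᶠ z in 𝓝 y, G z < 0 :=
    hc.lipschitz.continuous.continuousAt.eventually_lt continuousAt_const hneg
  obtain ⟨z, ⟨hz1, hz2⟩, hz3⟩ := mem_closure_iff_nhds.1 hyΩ _
    (h1.and (Metric.isOpen_ball.mem_nhds hy))
  exact absurd ((hc.mem_iff z hz2).1 hz3) (not_lt.2 hz1.le)

/-- The Lipschitz bound on `G` puts a truncated open convex cone with apex `x` and axis `-ν` inside
`Ω`, and a convex set with nonempty interior determines derivatives at every point of its closure.
-/
theorem uniqueDiffWithinAt (hc : IsGraphChart Ω x r ν L G) (hx : x ∈ closure Ω) :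
    UniqueDiffWithinAt ℝ (closure Ω) x := by
  have hGx := hc.nonneg_of_mem_closure (Metric.mem_ball_self hc.radius_pos) hx
  let q : Space d → ℝ := fun y => L * ‖(y - x) - inner ℝ ν (y - x) • ν‖ + inner ℝ ν (y - x)
  have hqc : Continuous q := by fun_prop
  let T : Set (Space d) := Metric.ball x r ∩ {y | q y < 0}
  have hTo : IsOpen T := Metric.isOpen_ball.inter (isOpen_lt hqc continuous_const)
  have hTΩ : T ⊆ Ω := by
    rintro y ⟨hy, hq⟩
    rw [hc.mem_iff y hy]
    have e : y = (x + ((y - x) - inner ℝ ν (y - x) • ν)) + inner ℝ ν (y - x) • ν := by abel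
    have h1 := hc.lipschitz.dist_le_mul (x + ((y - x) - inner ℝ ν (y - x) • ν)) x
    rw [dist_eq_norm, dist_eq_norm, add_sub_cancel_left, Real.norm_eq_abs] at h1
    have h2 := (abs_le.1 h1).1
    rw [e, hc.add_smul]
    simp only [q, mem_ofPred_eq] at hq
    linarith
  have hmem : ∀ t : ℝ, 0 < t → t < r → x + (-t) • ν ∈ T := by
    intro t ht htr
    refine ⟨?_, ?_⟩
    · simp [norm_smul, hc.norm_dir, abs_of_pos ht, htr]
    · simp [q, real_inner_smul_right, inner_neg_right, hc.norm_dir, ht]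
  have hconv : Convex ℝ T := by
    refine (convex_ball x r).inter ?_
    rintro a ha b hb s t hs ht hst
    simp only [mem_ofPred_eq, q] at ha hb ⊢
    have e : s • a + t • b - x = s • (a - x) + t • (b - x) := by
      have : x = (s + t) • x := by rw [hst, one_smul]
      conv_lhs => rw [this]
      module
    rw [e]
    have e2 : s • (a - x) + t • (b - x) - inner ℝ ν (s • (a - x) + t • (b - x)) • ν
        = s • ((a - x) - inner ℝ ν (a - x) • ν) + t • ((b - x) - inner ℝ ν (b - x) • ν) := by
      rw [inner_add_right, real_inner_smul_right, real_inner_smul_right]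
      module
    rw [e2, inner_add_right, real_inner_smul_right, real_inner_smul_right]
    set A := (a - x) - inner ℝ ν (a - x) • ν
    set B := (b - x) - inner ℝ ν (b - x) • ν
    have h1 : ‖s • A + t • B‖ ≤ s * ‖A‖ + t * ‖B‖ := by
      refine (norm_add_le _ _).trans ?_
      rw [norm_smul, norm_smul, Real.norm_of_nonneg hs, Real.norm_of_nonneg ht]
    have h2 := mul_le_mul_of_nonneg_left h1 L.2
    rw [NNReal.val_eq_coe] at h2
    -- A weight may vanish, so strictness comes from `b` when `s = 0` and from `a` otherwise.
    rcases hs.eq_or_lt with rfl | hs'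
    · have : t = 1 := by linarith
      subst this
      nlinarith
    · nlinarith [mul_neg_of_pos_of_neg hs' ha, mul_nonpos_of_nonneg_of_nonpos ht hb.le]
  have hxT : x ∈ closure T := by
    have h1 : Tendsto (fun t : ℝ => x + (-t) • ν) (𝓝[>] 0) (𝓝 x) := by
      have : Tendsto (fun t : ℝ => x + (-t) • ν) (𝓝 0) (𝓝 (x + (-(0 : ℝ)) • ν)) :=
        Continuous.tendsto (by fun_prop) 0
      rw [neg_zero, zero_smul, add_zero] at this
      exact this.mono_left nhdsWithin_le_nhds
    refine mem_closure_of_tendsto h1 ?_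
    filter_upwards [Ioo_mem_nhdsGT hc.radius_pos] with t ht
    exact hmem t ht.1 ht.2
  refine (uniqueDiffWithinAt_convex hconv ?_ hxT).mono (hTΩ.trans subset_closure)
  rw [hTo.interior_eq]
  exact ⟨_, hmem (r / 2) (half_pos hc.radius_pos) (half_lt_self hc.radius_pos)⟩

/-- Along `ν` the function `G` changes only by a constant. This carries the gradient from a point of
the boundary layer to the boundary point above it. -/
theorem hasFDerivAt_add_smul (hc : IsGraphChart Ω x r ν L G) {y : Space d} {A : Space d →L[ℝ] ℝ}
    (h : HasFDerivAt G A y) (t : ℝ) : HasFDerivAt G A (y + t • ν) := by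
  have h1 : HasFDerivAt (fun z => G (z - t • ν)) A (y + t • ν) := by
    have h2 : HasFDerivAt (fun z : Space d => z - t • ν) (ContinuousLinearMap.id ℝ _)
        (y + t • ν) := (hasFDerivAt_id _).sub_const _
    have h3 : HasFDerivAt G A (y + t • ν - t • ν) := by rwa [add_sub_cancel_right]
    exact h3.comp (y + t • ν) h2
  have h2 : G = fun z => G (z - t • ν) - t := by
    funext z
    rw [← hc.add_smul, sub_add_cancel]
  rw [h2]
  exact h1.sub_const t

theorem fderiv_dir (hc : IsGraphChart Ω x r ν L G) {y : Space d} {A : Space d →L[ℝ] ℝ}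
    (h : HasFDerivAt G A y) : A ν = -1 := by
  have h1 := (h.hasLineDerivAt ν)
  have h2 : HasDerivAt (fun t : ℝ => G (y + t • ν)) (-1) 0 := by
    simp only [hc.add_smul]
    simpa using (hasDerivAt_id (0 : ℝ)).const_sub (G y)
  exact HasDerivAt.unique h1 h2

theorem mem_frontier (hΩ : IsOpen Ω) (hc : IsGraphChart Ω x r ν L G) {b : Space d}
    (hb : b ∈ Metric.ball x r) (hG : G b = 0) : b ∈ frontier Ω := by
  rw [hΩ.frontier_eq]
  refine ⟨?_, fun h => ?_⟩
  · have h1 : Tendsto (fun t : ℝ => b + (-t) • ν) (𝓝[>] 0) (𝓝 b) := by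
      have : Tendsto (fun t : ℝ => b + (-t) • ν) (𝓝 0) (𝓝 (b + (-(0 : ℝ)) • ν)) :=
        Continuous.tendsto (by fun_prop) 0
      rw [neg_zero, zero_smul, add_zero] at this
      exact this.mono_left nhdsWithin_le_nhds
    refine mem_closure_of_tendsto h1 ?_
    filter_upwards [h1 (Metric.isOpen_ball.mem_nhds hb), self_mem_nhdsWithin] with t ht ht0
    rw [hc.mem_iff _ ht, hc.add_smul, hG]
    simpa using ht0
  · rw [hc.mem_iff b hb, hG] at h
    exact lt_irrefl _ h

/-- The normal is `-∇G / ‖∇G‖`: the gradient is nonzero because its component along `ν` is `-1`, and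
the first-order expansion of `G` with error `ε ‖∇G‖ ‖y - b‖` gives both cone conditions. -/
theorem exists_normal (hc : IsGraphChart Ω x r ν L G) {b : Space d} {A : Space d →L[ℝ] ℝ}
    (hb : b ∈ Metric.ball x r) (hG : G b = 0) (h : HasFDerivAt G A b) :
    ∃ N c, IsOuterUnitNormal Ω b N ∧ ∀ z, A z = c * inner ℝ N z := by
  set g : Space d := (InnerProductSpace.toDual ℝ (Space d)).symm A with hg
  have hA : ∀ z, A z = inner ℝ g z := fun z => by
    rw [hg, InnerProductSpace.toDual_symm_apply]
  have hg0 : g ≠ 0 := by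
    intro h0
    have := hc.fderiv_dir h
    rw [hA, h0, inner_zero_left] at this
    norm_num at this
  have hgp : 0 < ‖g‖ := norm_pos_iff.2 hg0
  refine ⟨(-‖g‖⁻¹) • g, -‖g‖, ⟨?_, fun ε hε => ?_⟩, fun z => ?_⟩
  · rw [norm_smul, norm_neg, norm_inv, norm_norm, inv_mul_cancel₀ hgp.ne']
  · have h1 := h.isLittleO.def (mul_pos hε hgp)
    filter_upwards [h1, Metric.isOpen_ball.mem_nhds hb] with y hy hyb
    rw [hc.mem_iff y hyb, real_inner_smul_left, ← hA]
    rw [hG, sub_zero, Real.norm_eq_abs, abs_le] at hy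
    have key : -‖g‖⁻¹ * A (y - b) * ‖g‖ = - A (y - b) := by field_simp
    refine ⟨fun hlt => ?_, fun hlt => ?_⟩
    · have := mul_lt_mul_of_pos_right hlt hgp
      rw [key] at this
      nlinarith
    · have := mul_lt_mul_of_pos_right hlt hgp
      rw [key] at this
      refine not_lt.2 ?_
      nlinarith
  · rw [hA, real_inner_smul_left]
    field_simp

/-- Shifting by `k / n` along `ν` lowers `n G` by exactly `k`, so the `n` shifted copies of the
strip are disjoint. They have equal volume and stay in the ball enlarged by 1. -/
theorem natCast_mul_volume_strip_le (hc : IsGraphChart Ω x r ν L G) (ρ : ℝ) {n : ℕ} (hn : 0 < n) :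
    (n : ℝ) * volume.real (Metric.closedBall x ρ ∩ {y | 1 < n * G y ∧ n * G y < 2})
      ≤ volume.real (Metric.closedBall x (ρ + 1)) := by
  have hn' : (0 : ℝ) < n := by exact_mod_cast hn
  set S := Metric.closedBall x ρ ∩ {y | 1 < n * G y ∧ n * G y < 2} with hS
  have hSm : MeasurableSet S :=
    Metric.isClosed_closedBall.measurableSet.inter
      ((isOpen_lt continuous_const (continuous_const.mul hc.lipschitz.continuous)).inter
        (isOpen_lt (continuous_const.mul hc.lipschitz.continuous) continuous_const)).measurableSet
  let T : ℕ → Set (Space d) := fun k => (fun y => y + ((k : ℝ) / n) • ν) ⁻¹' S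
  have hTv : ∀ k, volume.real (T k) = volume.real S := fun k => by
    simp only [Measure.real, T]
    rw [measure_preimage_add_right]
  have hTm : ∀ k, MeasurableSet (T k) := fun k => by
    have : Continuous fun y : Space d => y + ((k : ℝ) / n) • ν := by fun_prop
    exact this.measurable hSm
  have hTd : Pairwise (Function.onFun Disjoint T) := by
    intro j k hjk
    rw [Function.onFun, Set.disjoint_left]
    rintro y ⟨-, h1, h2⟩ ⟨-, h3, h4⟩
    rw [hc.add_smul, mul_sub, mul_div_cancel₀ _ hn'.ne'] at h1 h2 h3 h4
    apply hjk
    have a1 : (j : ℝ) < k + 1 := by linarith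
    have a2 : (k : ℝ) < j + 1 := by linarith
    have b1 : j < k + 1 := by exact_mod_cast a1
    have b2 : k < j + 1 := by exact_mod_cast a2
    omega
  have hTs : (⋃ k ∈ Finset.range n, T k) ⊆ Metric.closedBall x (ρ + 1) := by
    intro y hy
    simp only [mem_iUnion, Finset.mem_range] at hy
    obtain ⟨k, hk, hy⟩ := hy
    have h1 := hy.1
    rw [Metric.mem_closedBall, dist_eq_norm] at h1 ⊢
    have e : y - x = (y + ((k : ℝ) / n) • ν - x) - ((k : ℝ) / n) • ν := by abel
    rw [e]
    refine (norm_sub_le _ _).trans (add_le_add h1 ?_)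
    rw [norm_smul, hc.norm_dir, mul_one, Real.norm_of_nonneg (by positivity), div_le_one hn']
    exact_mod_cast hk.le
  calc (n : ℝ) * volume.real S = ∑ k ∈ Finset.range n, volume.real (T k) := by simp [hTv]
    _ = volume.real (⋃ k ∈ Finset.range n, T k) :=
        (measureReal_biUnion_finset (fun j _ k _ hjk => hTd hjk) (fun k _ => hTm k)
          (fun k _ => by
            simp only [T]
            rw [measure_preimage_add_right]
            exact ne_top_of_le_ne_top (measure_closedBall_lt_top (x := x) (r := ρ)).ne
              (measure_mono inter_subset_left))).symm
    _ ≤ _ := measureReal_mono hTs measure_closedBall_lt_top.ne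

end IsGraphChart

theorem IsBoundedLipschitzDomain.uniqueDiffOn {d : ℕ} [NeZero d] {Ω : Set (Space d)}
    (hΩ : IsBoundedLipschitzDomain Ω) : UniqueDiffOn ℝ (closure Ω) := by
  intro x hx
  obtain ⟨r, ν, L, G, hc⟩ := hΩ.exists_chart hx
  exact hc.uniqueDiffWithinAt hx

/-! ### Differential calculus up to the boundary -/

section Calculus

variable {d : ℕ} {Ω : Set (Space d)}

theorem pd_eq_fderiv (hΩ : IsOpen Ω) (i : Fin d) (f : Space d → ℝ) {x : Space d} (hx : x ∈ Ω) :
    pd Ω i f x = fderiv ℝ f x (EuclideanSpace.single i 1) := by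
  rw [pd, fderivWithin_of_mem_nhds (mem_of_superset (hΩ.mem_nhds hx) subset_closure)]

theorem pd_congr {f g : Space d → ℝ} (h : EqOn f g (closure Ω)) (i : Fin d) {x : Space d}
    (hx : x ∈ closure Ω) : pd Ω i f x = pd Ω i g x := by
  rw [pd, pd, fderivWithin_congr h (h hx)]

theorem contDiffOn_pd (hu : UniqueDiffOn ℝ (closure Ω)) {f : Space d → ℝ} {m n : WithTop ℕ∞}
    (hf : ContDiffOn ℝ n f (closure Ω)) (hmn : m + 1 ≤ n) (i : Fin d) :
    ContDiffOn ℝ m (pd Ω i f) (closure Ω) :=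
  (hf.fderivWithin hu hmn).clm_apply contDiffOn_const

theorem pd_add (hu : UniqueDiffOn ℝ (closure Ω)) {f g : Space d → ℝ}
    (hf : ContDiffOn ℝ 1 f (closure Ω)) (hg : ContDiffOn ℝ 1 g (closure Ω)) (i : Fin d)
    {x : Space d} (hx : x ∈ closure Ω) :
    pd Ω i (fun y => f y + g y) x = pd Ω i f x + pd Ω i g x := by
  simp only [pd]
  rw [fderivWithin_fun_add (hu x hx) (hf.differentiableOn one_ne_zero x hx)
    (hg.differentiableOn one_ne_zero x hx)]
  rfl

theorem pd_sub (hu : UniqueDiffOn ℝ (closure Ω)) {f g : Space d → ℝ}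
    (hf : ContDiffOn ℝ 1 f (closure Ω)) (hg : ContDiffOn ℝ 1 g (closure Ω)) (i : Fin d)
    {x : Space d} (hx : x ∈ closure Ω) :
    pd Ω i (fun y => f y - g y) x = pd Ω i f x - pd Ω i g x := by
  simp only [pd]
  rw [fderivWithin_fun_sub (hu x hx) (hf.differentiableOn one_ne_zero x hx)
    (hg.differentiableOn one_ne_zero x hx)]
  rfl

theorem pd_mul (hu : UniqueDiffOn ℝ (closure Ω)) {f g : Space d → ℝ}
    (hf : ContDiffOn ℝ 1 f (closure Ω)) (hg : ContDiffOn ℝ 1 g (closure Ω)) (i : Fin d)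
    {x : Space d} (hx : x ∈ closure Ω) :
    pd Ω i (fun y => f y * g y) x = f x * pd Ω i g x + pd Ω i f x * g x := by
  simp only [pd]
  rw [fderivWithin_fun_mul (hu x hx) (hf.differentiableOn one_ne_zero x hx)
    (hg.differentiableOn one_ne_zero x hx)]
  simp [mul_comm]

theorem pd_const_mul (hu : UniqueDiffOn ℝ (closure Ω)) (c : ℝ) {f : Space d → ℝ}
    (hf : ContDiffOn ℝ 1 f (closure Ω)) (i : Fin d) {x : Space d} (hx : x ∈ closure Ω) :
    pd Ω i (fun y => c * f y) x = c * pd Ω i f x := by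
  simp only [pd]
  rw [fderivWithin_const_mul (hu x hx) (hf.differentiableOn one_ne_zero x hx)]
  rfl

theorem pd_sum (hu : UniqueDiffOn ℝ (closure Ω)) {ι : Type*} (s : Finset ι)
    {f : ι → Space d → ℝ} (hf : ∀ k ∈ s, ContDiffOn ℝ 1 (f k) (closure Ω)) (i : Fin d)
    {x : Space d} (hx : x ∈ closure Ω) :
    pd Ω i (fun y => ∑ k ∈ s, f k y) x = ∑ k ∈ s, pd Ω i (f k) x := by
  simp only [pd]
  rw [fderivWithin_fun_sum (hu x hx)
    (fun k hk => (hf k hk).differentiableOn one_ne_zero x hx)]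
  simp

/-- Near an interior point `pd` is the ordinary partial derivative, so symmetry of the second
derivative applies. -/
theorem pd_pd_comm (hΩ : IsOpen Ω) {f : Space d → ℝ} (hf : ContDiffOn ℝ 2 f (closure Ω))
    (i j : Fin d) {x : Space d} (hx : x ∈ Ω) :
    pd Ω i (pd Ω j f) x = pd Ω j (pd Ω i f) x := by
  have hfx : ContDiffAt ℝ 2 f x :=
    hf.contDiffAt (mem_of_superset (hΩ.mem_nhds hx) subset_closure)
  have hd : DifferentiableAt ℝ (fderiv ℝ f) x :=
    (hfx.fderiv_right (m := 1) (by norm_num)).differentiableAt one_ne_zero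
  have key : ∀ k l : Fin d, pd Ω k (pd Ω l f) x
      = fderiv ℝ (fderiv ℝ f) x (EuclideanSpace.single k 1) (EuclideanSpace.single l 1) := by
    intro k l
    rw [pd_eq_fderiv hΩ k _ hx]
    have h1 : pd Ω l f =ᶠ[𝓝 x] fun y => fderiv ℝ f y (EuclideanSpace.single l 1) := by
      filter_upwards [hΩ.mem_nhds hx] with y hy using pd_eq_fderiv hΩ l f hy
    rw [h1.fderiv_eq, fderiv_clm_apply hd (differentiableAt_const _)]
    simp
  rw [key, key]
  exact hfx.isSymmSndFDerivAt (by simp) _ _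

theorem contDiffOn_comp {n : WithTop ℕ∞} {v : Space d → Space d} {s : Set (Space d)}
    (hv : ContDiffOn ℝ n v s) (i : Fin d) : ContDiffOn ℝ n (fun y => v y i) s :=
  contDiffOn_euclidean.1 hv i

theorem contDiffOn_grad (hu : UniqueDiffOn ℝ (closure Ω)) {f : Space d → ℝ} {m n : WithTop ℕ∞}
    (hf : ContDiffOn ℝ n f (closure Ω)) (hmn : m + 1 ≤ n) :
    ContDiffOn ℝ m (grad Ω f) (closure Ω) :=
  contDiffOn_euclidean.2 fun i => contDiffOn_pd hu hf hmn i

theorem contDiffOn_lap (hu : UniqueDiffOn ℝ (closure Ω)) {f : Space d → ℝ} {l m n : WithTop ℕ∞}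
    (hf : ContDiffOn ℝ n f (closure Ω)) (hmn : m + 1 ≤ n) (hlm : l + 1 ≤ m) :
    ContDiffOn ℝ l (lap Ω f) (closure Ω) :=
  ContDiffOn.sum fun i _ => contDiffOn_pd hu (contDiffOn_pd hu hf hmn i) hlm i

theorem contDiffOn_vlap (hu : UniqueDiffOn ℝ (closure Ω)) {v : Space d → Space d}
    {l m n : WithTop ℕ∞} (hv : ContDiffOn ℝ n v (closure Ω)) (hmn : m + 1 ≤ n)
    (hlm : l + 1 ≤ m) : ContDiffOn ℝ l (vlap Ω v) (closure Ω) :=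
  contDiffOn_euclidean.2 fun i => contDiffOn_lap hu (contDiffOn_comp hv i) hmn hlm

theorem grad_add (hu : UniqueDiffOn ℝ (closure Ω)) {f g : Space d → ℝ}
    (hf : ContDiffOn ℝ 1 f (closure Ω)) (hg : ContDiffOn ℝ 1 g (closure Ω))
    {x : Space d} (hx : x ∈ closure Ω) :
    grad Ω (fun y => f y + g y) x = grad Ω f x + grad Ω g x := by
  ext i; exact pd_add hu hf hg i hx

theorem grad_sub (hu : UniqueDiffOn ℝ (closure Ω)) {f g : Space d → ℝ}
    (hf : ContDiffOn ℝ 1 f (closure Ω)) (hg : ContDiffOn ℝ 1 g (closure Ω))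
    {x : Space d} (hx : x ∈ closure Ω) :
    grad Ω (fun y => f y - g y) x = grad Ω f x - grad Ω g x := by
  ext i; exact pd_sub hu hf hg i hx

theorem grad_const_mul (hu : UniqueDiffOn ℝ (closure Ω)) (c : ℝ) {f : Space d → ℝ}
    (hf : ContDiffOn ℝ 1 f (closure Ω)) {x : Space d} (hx : x ∈ closure Ω) :
    grad Ω (fun y => c * f y) x = c • grad Ω f x := by
  ext i; exact pd_const_mul hu c hf i hx

theorem grad_comp (hu : UniqueDiffOn ℝ (closure Ω)) {h : ℝ → ℝ} {h' : ℝ} {f : Space d → ℝ}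
    (hf : ContDiffOn ℝ 1 f (closure Ω)) {x : Space d} (hh : HasDerivAt h h' (f x))
    (hx : x ∈ closure Ω) :
    grad Ω (fun y => h (f y)) x = h' • grad Ω f x := by
  ext i
  have h1 := hh.comp_hasFDerivWithinAt x
    (hf.differentiableOn one_ne_zero x hx).hasFDerivWithinAt
  have h2 := h1.fderivWithin (hu x hx)
  simp only [grad, pd, PiLp.smul_apply]
  change fderivWithin ℝ (h ∘ f) (closure Ω) x _ = _
  rw [h2]
  rfl

theorem inner_eq_sum (a b : Space d) : inner ℝ a b = ∑ i, a i * b i := by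
  simp [PiLp.inner_apply, mul_comm]

theorem divg_smul (hu : UniqueDiffOn ℝ (closure Ω)) {f : Space d → ℝ} {v : Space d → Space d}
    (hf : ContDiffOn ℝ 1 f (closure Ω)) (hv : ContDiffOn ℝ 1 v (closure Ω))
    {x : Space d} (hx : x ∈ closure Ω) :
    divg Ω (fun y => f y • v y) x = f x * divg Ω v x + inner ℝ (grad Ω f x) (v x) := by
  rw [inner_eq_sum, divg, divg, Finset.mul_sum, ← Finset.sum_add_distrib]
  refine Finset.sum_congr rfl fun i _ => ?_
  exact pd_mul hu hf (contDiffOn_comp hv i) i hx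

theorem divg_sub (hu : UniqueDiffOn ℝ (closure Ω)) {v w : Space d → Space d}
    (hv : ContDiffOn ℝ 1 v (closure Ω)) (hw : ContDiffOn ℝ 1 w (closure Ω))
    {x : Space d} (hx : x ∈ closure Ω) :
    divg Ω (fun y => v y - w y) x = divg Ω v x - divg Ω w x := by
  rw [divg, divg, divg, ← Finset.sum_sub_distrib]
  exact Finset.sum_congr rfl fun i _ =>
    pd_sub hu (contDiffOn_comp hv i) (contDiffOn_comp hw i) i hx

theorem divg_sum (hu : UniqueDiffOn ℝ (closure Ω)) {ι : Type*} (s : Finset ι)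
    {v : ι → Space d → Space d} (hv : ∀ k ∈ s, ContDiffOn ℝ 1 (v k) (closure Ω))
    {x : Space d} (hx : x ∈ closure Ω) :
    divg Ω (fun y => ∑ k ∈ s, v k y) x = ∑ k ∈ s, divg Ω (v k) x := by
  simp only [divg]
  rw [Finset.sum_comm]
  refine Finset.sum_congr rfl fun i _ => ?_
  rw [← pd_sum hu s (fun k hk => contDiffOn_comp (hv k hk) i) i hx]
  simp

theorem divg_congr {v w : Space d → Space d} (h : EqOn v w (closure Ω)) {x : Space d}
    (hx : x ∈ closure Ω) : divg Ω v x = divg Ω w x :=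
  Finset.sum_congr rfl fun i _ => pd_congr (fun y hy => by simp only [h hy]) i hx

theorem continuousOn_divg (hu : UniqueDiffOn ℝ (closure Ω)) {v : Space d → Space d}
    (hv : ContDiffOn ℝ 1 v (closure Ω)) : ContinuousOn (divg Ω v) (closure Ω) :=
  continuousOn_finsetSum _ fun i _ =>
    (contDiffOn_pd (m := 0) hu (contDiffOn_comp hv i) (by norm_num) i).continuousOn

end Calculus

/-! ### Integrability, extensions and boundary-layer cutoffs -/

theorem IsBoundedLipschitzDomain.isCompact_closure {d : ℕ} {Ω : Set (Space d)}
    (hΩ : IsBoundedLipschitzDomain Ω) : IsCompact (closure Ω) :=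
  Metric.isCompact_of_isClosed_isBounded isClosed_closure hΩ.isBounded.closure

theorem IsBoundedLipschitzDomain.integrableOn {d : ℕ} {Ω : Set (Space d)}
    (hΩ : IsBoundedLipschitzDomain Ω) {f : Space d → ℝ} (hf : ContinuousOn f (closure Ω)) :
    IntegrableOn f Ω :=
  (hf.integrableOn_compact hΩ.isCompact_closure).mono_set subset_closure

open scoped Manifold ContDiff in
/-- A `C¹` field on `closure Ω` agrees near a compact subset of `Ω` with a `C¹` field on the whole
space which vanishes wherever the original field does. -/
theorem exists_contDiff_extension {d : ℕ} {Ω : Set (Space d)} (hΩ : IsOpen Ω) {w : Space d → Space d}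
    (hw : ContDiffOn ℝ 1 w (closure Ω)) {K : Set (Space d)} (hK : IsClosed K) (hKΩ : K ⊆ Ω) :
    ∃ θ : Space d → ℝ, ContDiff ℝ 1 (fun y => θ y • w y) ∧ ∀ y ∈ K, ∀ᶠ z in 𝓝 y, θ z = 1 := by
  obtain ⟨θ, h0, h1, -⟩ := exists_contMDiffMap_zero_one_nhds_of_isClosed (n := 1) 𝓘(ℝ, Space d)
    hΩ.isClosed_compl hK (disjoint_left.2 fun y hy hyK => hy (hKΩ hyK))
  rw [eventually_nhdsSet_iff_forall] at h0 h1
  refine ⟨θ, contDiff_iff_contDiffAt.2 fun y => ?_, h1⟩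
  by_cases hy : y ∈ Ω
  · have hθ : ContDiffAt ℝ 1 θ y := θ.contMDiff.contDiff.contDiffAt
    exact hθ.smul (hw.contDiffAt (mem_of_superset (hΩ.mem_nhds hy) subset_closure))
  · have : (fun z => θ z • w z) =ᶠ[𝓝 y] fun _ => 0 := by
      filter_upwards [h0 y hy] with z hz
      rw [hz, zero_smul]
    exact contDiffAt_const.congr_of_eventuallyEq this

/-- The cutoff that vanishes for `n G ≤ 1` and equals `1` for `2 ≤ n G`. -/
def layerCutoff {d : ℕ} (G : Space d → ℝ) (n : ℕ) (y : Space d) : ℝ :=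
  min 1 (max 0 (n * G y - 1))

section layerCutoff

variable {d : ℕ} {G : Space d → ℝ} {n : ℕ} {y : Space d}

theorem layerCutoff_nonneg : 0 ≤ layerCutoff G n y :=
  le_min zero_le_one (le_max_left _ _)

theorem layerCutoff_le_one : layerCutoff G n y ≤ 1 := min_le_left _ _

theorem layerCutoff_eq_zero (h : n * G y ≤ 1) : layerCutoff G n y = 0 := by
  rw [layerCutoff, max_eq_left (by linarith), min_eq_right zero_le_one]

theorem layerCutoff_eq_one (h : 2 ≤ n * G y) : layerCutoff G n y = 1 := by
  rw [layerCutoff, max_eq_right (by linarith), min_eq_left (by linarith)]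

theorem layerCutoff_eq_sub (h1 : 1 ≤ n * G y) (h2 : n * G y ≤ 2) :
    layerCutoff G n y = n * G y - 1 := by
  rw [layerCutoff, max_eq_right (by linarith), min_eq_right (by linarith)]

theorem exists_lipschitzWith_layerCutoff {L : ℝ≥0} (hG : LipschitzWith L G) (n : ℕ) :
    ∃ C, LipschitzWith C (layerCutoff G n) := by
  have h1 : LipschitzWith (‖(n : ℝ)‖₊ * L) fun y => (n : ℝ) * G y :=
    (lipschitzWith_smul (n : ℝ)).comp hG
  exact ⟨_, ((h1.sub (LipschitzWith.const 1)).const_max 0).const_min 1⟩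

/-- Such a point is a global minimum or maximum of the cutoff, so `fderiv` is zero there, even at a
kink, where it is zero by convention. -/
theorem fderiv_layerCutoff_of_not_mem_strip (h : ¬ (1 < n * G y ∧ n * G y < 2)) :
    fderiv ℝ (layerCutoff G n) y = 0 := by
  rw [not_and_or, not_lt, not_lt] at h
  rcases h with h | h
  · refine IsLocalMin.fderiv_eq_zero (Eventually.of_forall fun z => ?_)
    rw [layerCutoff_eq_zero h]
    exact layerCutoff_nonneg
  · refine IsLocalMax.fderiv_eq_zero (Eventually.of_forall fun z => ?_)
    rw [layerCutoff_eq_one h]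
    exact layerCutoff_le_one

theorem fderiv_layerCutoff_of_mem_strip (hG : Continuous G) {A : Space d →L[ℝ] ℝ}
    (hA : HasFDerivAt G A y) (h1 : 1 < n * G y) (h2 : n * G y < 2) :
    fderiv ℝ (layerCutoff G n) y = (n : ℝ) • A := by
  have hcont : ContinuousAt (fun z => (n : ℝ) * G z) y :=
    (continuous_const.mul hG).continuousAt
  have he : layerCutoff G n =ᶠ[𝓝 y] fun z => (n : ℝ) * G z - 1 := by
    filter_upwards [continuousAt_const.eventually_lt hcont h1,
      hcont.eventually_lt continuousAt_const h2] with z hz1 hz2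
    exact layerCutoff_eq_sub hz1.le hz2.le
  rw [he.fderiv_eq]
  exact ((hA.const_mul (n : ℝ)).sub_const 1).fderiv

end layerCutoff

/-! ### The divergence theorem for zero normal trace -/

namespace IsGraphChart

variable {d : ℕ} {Ω : Set (Space d)} {x : Space d} {r : ℝ} {ν : Space d} {L : ℝ≥0}
  {G : Space d → ℝ}

/-- At the boundary point `b = y + G y • ν` the derivative `A` is a multiple of the normal and kills
`w b`. Hence `A (w y) = A (w y - w b)`, and `b` is within `2 / n` of `y`. -/
theorem abs_fderiv_apply_le (hΩ : IsOpen Ω) (hc : IsGraphChart Ω x r ν L G)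
    {w : Space d → Space d} (hn : NormalTraceEq Ω w 0) {n : ℕ} (hn0 : 0 < n)
    {ρ : ℝ} (hρ : ρ + 2 / n < r) {η : ℝ}
    (hmod : ∀ a ∈ closure Ω, ∀ b ∈ closure Ω, dist a b ≤ 2 / n → ‖w a - w b‖ ≤ η)
    {y : Space d} (hy : y ∈ Metric.closedBall x ρ) (h1 : 1 < n * G y) (h2 : n * G y < 2)
    {A : Space d →L[ℝ] ℝ} (hA : HasFDerivAt G A y) : |A (w y)| ≤ L * η := by
  have hn' : (0 : ℝ) < n := by exact_mod_cast hn0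
  have hGpos : 0 < G y := by
    by_contra! h
    nlinarith
  have hGle : G y ≤ 2 / n := by
    rw [le_div_iff₀ hn']; linarith
  set b := y + G y • ν with hb
  have hyb : dist y b ≤ 2 / n := by
    rw [dist_eq_norm, hb, sub_add_cancel_left, norm_neg, norm_smul, hc.norm_dir, mul_one,
      Real.norm_of_nonneg hGpos.le]
    exact hGle
  have hbB : b ∈ Metric.ball x r := by
    rw [Metric.mem_ball]
    have := dist_triangle_left b x y
    rw [Metric.mem_closedBall] at hy
    linarith
  have hyB : y ∈ Metric.ball x r := by
    rw [Metric.mem_ball]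
    rw [Metric.mem_closedBall] at hy
    have : 0 < 2 / (n : ℝ) := by positivity
    linarith
  have hGb : G b = 0 := by rw [hb, hc.add_smul, sub_self]
  have hbf := hc.mem_frontier hΩ hbB hGb
  obtain ⟨N, c, hN, hAN⟩ := hc.exists_normal hbB hGb (hc.hasFDerivAt_add_smul hA (G y))
  have hAb : A (w b) = 0 := by
    rw [hAN, hn b hbf N hN]; simp
  have hyΩ : y ∈ Ω := (hc.mem_iff y hyB).2 hGpos
  have hAL : ‖A‖ ≤ L := hA.fderiv ▸ norm_fderiv_le_of_lipschitz ℝ hc.lipschitz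
  calc |A (w y)| = ‖A (w y - w b)‖ := by rw [map_sub, hAb, sub_zero, Real.norm_eq_abs]
    _ ≤ ‖A‖ * ‖w y - w b‖ := A.le_opNorm _
    _ ≤ L * η := mul_le_mul hAL (hmod y (subset_closure hyΩ) b (frontier_subset_closure hbf) hyb)
        (norm_nonneg _) L.2

/-- Integration by parts moves the derivative onto the cutoff. The factor `n` in its gradient is
paid for by the volume of the strip. -/
theorem abs_setIntegral_layerCutoff_mul_divg_le (hΩ : IsOpen Ω) (hc : IsGraphChart Ω x r ν L G)
    {w : Space d → Space d} (hw : ContDiffOn ℝ 1 w (closure Ω)) (hn : NormalTraceEq Ω w 0)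
    {n : ℕ} (hn0 : 0 < n) {ρ : ℝ} (hρ : ρ + 2 / n < r) (hsupp : tsupport w ⊆ Metric.closedBall x ρ)
    {η : ℝ} (hη : 0 ≤ η)
    (hmod : ∀ a ∈ closure Ω, ∀ b ∈ closure Ω, dist a b ≤ 2 / n → ‖w a - w b‖ ≤ η) :
    |∫ y in Ω, layerCutoff G n y * divg Ω w y|
      ≤ L * η * volume.real (Metric.closedBall x (ρ + 1)) := by
  have hn' : (0 : ℝ) < n := by exact_mod_cast hn0
  have hGc := hc.lipschitz.continuous
  have hρr : Metric.closedBall x ρ ⊆ Metric.ball x r := by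
    refine Metric.closedBall_subset_ball ?_
    have : 0 < 2 / (n : ℝ) := by positivity
    linarith
  set χ := layerCutoff G n with hχ
  obtain ⟨C, hχL⟩ := exists_lipschitzWith_layerCutoff hc.lipschitz n
  -- Outside `K` the cutoff or `w` vanishes. As `w` is only regular on the closure, it is replaced
  -- by `θ • w`, which is `C¹` on the whole space and equals `w` near `K`.
  set K := tsupport w ∩ {y | 1 ≤ n * G y} with hKdef
  have hK : IsClosed K :=
    (isClosed_tsupport w).inter (isClosed_le continuous_const (continuous_const.mul hGc))
  have hKΩ : K ⊆ Ω := by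
    rintro y ⟨hy, hy1⟩
    rw [hc.mem_iff y (hρr (hsupp hy))]
    by_contra! h
    have : (1 : ℝ) ≤ n * G y := hy1
    nlinarith
  obtain ⟨θ, hθw, hθ⟩ := exists_contDiff_extension hΩ hw hK hKΩ
  set v : Space d → Space d := fun y => θ y • w y with hv
  have hwc : HasCompactSupport w :=
    HasCompactSupport.of_support_subset_isCompact (isCompact_closedBall x ρ)
      ((subset_tsupport w).trans hsupp)
  have hvi : ∀ i : Fin d, ContDiff ℝ 1 fun y => v y i := fun i => contDiff_euclidean.1 hθw i
  have hvc : ∀ i : Fin d, HasCompactSupport fun y => v y i := fun i => by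
    refine hwc.mono fun y hy => ?_
    simp only [Function.mem_support, ne_eq] at hy ⊢
    intro h
    apply hy
    simp [hv, h]
  have hvL : ∀ i : Fin d, ∃ D, LipschitzWith D fun y => v y i := fun i =>
    (hvi i).lipschitzWith_of_hasCompactSupport (hvc i) one_ne_zero
  have hint : ∀ i : Fin d, Integrable
      (fun y => lineDeriv ℝ χ y (EuclideanSpace.single i 1) * v y i) := fun i =>
    Integrable.mul_of_top_right ((hvi i).continuous.integrable_of_hasCompactSupport (hvc i))
      (hχL.memLp_lineDeriv _)
  have hint2 : ∀ i : Fin d, Integrable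
      (fun y => lineDeriv ℝ (fun z => v z i) y (-EuclideanSpace.single i 1) * χ y) := fun i => by
    have e : ∀ y, lineDeriv ℝ (fun z => v z i) y (-EuclideanSpace.single i 1)
        = fderiv ℝ (fun z => v z i) y (-EuclideanSpace.single i 1) := fun y =>
      ((hvi i).differentiable one_ne_zero y).lineDeriv_eq_fderiv
    simp only [e]
    refine Continuous.integrable_of_hasCompactSupport ?_ ?_
    · exact (((hvi i).continuous_fderiv one_ne_zero).clm_apply continuous_const).mul
        hχL.continuous
    · refine HasCompactSupport.mul_right ?_
      exact ((hvc i).fderiv ℝ).comp_left (g := fun A : Space d →L[ℝ] ℝ =>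
        A (-EuclideanSpace.single i 1)) rfl
  have hibp : ∫ y, ∑ i, lineDeriv ℝ χ y (EuclideanSpace.single i 1) * v y i
      = ∫ y, ∑ i, lineDeriv ℝ (fun z => v z i) y (-EuclideanSpace.single i 1) * χ y := by
    rw [integral_finsetSum _ fun i _ => hint i, integral_finsetSum _ fun i _ => hint2 i]
    refine Finset.sum_congr rfl fun i _ => ?_
    obtain ⟨D, hD⟩ := hvL i
    exact hχL.integral_lineDeriv_mul_eq hD (hvc i) _
  -- On the support of `w` with `1 < n G` the extension agrees locally with `w`; elsewhere both
  -- sides are zero.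
  have hrhs : ∀ y, ∑ i, lineDeriv ℝ (fun z => v z i) y (-EuclideanSpace.single i 1) * χ y
      = -Ω.indicator (fun y => χ y * divg Ω w y) y := by
    intro y
    by_cases hyw : y ∈ tsupport w
    · by_cases hyG : 1 < n * G y
      · have hyK : y ∈ K := ⟨hyw, hyG.le⟩
        have hyΩ := hKΩ hyK
        rw [indicator_of_mem hyΩ, divg, Finset.mul_sum, ← Finset.sum_neg_distrib]
        refine Finset.sum_congr rfl fun i _ => ?_
        have he : (fun z => v z i) =ᶠ[𝓝 y] fun z => w z i := by
          filter_upwards [hθ y hyK] with z hz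
          simp [hv, hz]
        rw [((hvi i).differentiable one_ne_zero y).lineDeriv_eq_fderiv, he.fderiv_eq,
          pd_eq_fderiv hΩ i _ hyΩ, map_neg]
        ring
      · have : χ y = 0 := layerCutoff_eq_zero (not_lt.1 hyG)
        simp only [indicator, this]
        simp
    · have hw0 : w =ᶠ[𝓝 y] 0 := notMem_tsupport_iff_eventuallyEq.1 hyw
      have h1 : ∀ i : Fin d, lineDeriv ℝ (fun z => v z i) y (-EuclideanSpace.single i 1) = 0 := by
        intro i
        have he : (fun z => v z i) =ᶠ[𝓝 y] fun _ => 0 := by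
          filter_upwards [hw0] with z hz
          simp [hv, hz]
        rw [((hvi i).differentiable one_ne_zero y).lineDeriv_eq_fderiv, he.fderiv_eq]
        simp
      by_cases hyΩ : y ∈ Ω
      · have h2 : divg Ω w y = 0 := by
          refine Finset.sum_eq_zero fun i _ => ?_
          have he : (fun z => w z i) =ᶠ[𝓝 y] fun _ => 0 := by
            filter_upwards [hw0] with z hz
            simp [hz]
          rw [pd_eq_fderiv hΩ i _ hyΩ, he.fderiv_eq]
          simp
        simp [h1, indicator_of_mem hyΩ, h2]
      · simp [h1, indicator_of_notMem hyΩ]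
  simp only [hrhs] at hibp
  rw [integral_neg, integral_indicator hΩ.measurableSet] at hibp
  set S := Metric.closedBall x ρ ∩ {y | 1 < n * G y ∧ n * G y < 2} with hS
  have hSm : MeasurableSet S :=
    Metric.isClosed_closedBall.measurableSet.inter
      ((isOpen_lt continuous_const (continuous_const.mul hGc)).inter
        (isOpen_lt (continuous_const.mul hGc) continuous_const)).measurableSet
  have hSfin : volume S ≠ ⊤ := ne_top_of_le_ne_top measure_closedBall_lt_top.ne
    (measure_mono inter_subset_left)
  have hbound : ∀ᵐ y, ‖∑ i, lineDeriv ℝ χ y (EuclideanSpace.single i 1) * v y i‖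
      ≤ S.indicator (fun _ => n * (L * η)) y := by
    -- Rademacher's theorem, for the cutoff and for `G`, is why the bound is only almost everywhere.
    filter_upwards [hχL.ae_differentiableAt, hc.lipschitz.ae_differentiableAt] with y hy1 hy2
    have e : ∑ i, lineDeriv ℝ χ y (EuclideanSpace.single i 1) * v y i = fderiv ℝ χ y (v y) := by
      have hvy : v y = ∑ i, v y i • EuclideanSpace.single i (1 : ℝ) := by
        ext j
        simp [Finset.sum_apply, Pi.single_apply]
      conv_rhs => rw [hvy]
      rw [map_sum]
      refine Finset.sum_congr rfl fun i _ => ?_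
      rw [hy1.lineDeriv_eq_fderiv, map_smul, smul_eq_mul, mul_comm]
    rw [e]
    have hnonneg : 0 ≤ S.indicator (fun _ => n * (L * η)) y :=
      indicator_nonneg (fun _ _ => by positivity) y
    by_cases hyw : y ∈ tsupport w
    · by_cases hyG : 1 < n * G y ∧ n * G y < 2
      · have hyS : y ∈ S := ⟨hsupp hyw, hyG⟩
        have hθy : θ y = 1 := (hθ y ⟨hyw, hyG.1.le⟩).self_of_nhds
        rw [indicator_of_mem hyS, fderiv_layerCutoff_of_mem_strip hGc hy2.hasFDerivAt hyG.1 hyG.2]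
        have := hc.abs_fderiv_apply_le hΩ hn hn0 hρ hmod (hsupp hyw) hyG.1 hyG.2 hy2.hasFDerivAt
        rw [_root_.smul_apply, norm_smul, Real.norm_of_nonneg hn'.le]
        simp only [hv, hθy, one_smul]
        exact mul_le_mul_of_nonneg_left this hn'.le
      · rw [fderiv_layerCutoff_of_not_mem_strip hyG]
        simpa using hnonneg
    · have : v y = 0 := by simp [hv, image_eq_zero_of_notMem_tsupport hyw]
      simpa [this] using hnonneg
  have hle := norm_integral_le_of_norm_le
    ((integrable_indicator_iff hSm).2 (integrableOn_const hSfin)) hbound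
  rw [hibp, norm_neg, Real.norm_eq_abs, integral_indicator hSm, setIntegral_const,
    smul_eq_mul] at hle
  refine hle.trans ?_
  have := mul_le_mul_of_nonneg_left (hc.natCast_mul_volume_strip_le ρ hn0)
    (mul_nonneg L.2 hη)
  calc volume.real S * (n * (L * η)) = L * η * (n * volume.real S) := by ring
    _ ≤ _ := this

/-- On `Ω` the cutoffs tend to 1 at every point of the support of `w`, so dominated convergence
recovers the full integral, while the layer estimate sends the same sequence to zero. -/
theorem setIntegral_divg_eq_zero (hΩ : IsBoundedLipschitzDomain Ω)
    (hu : UniqueDiffOn ℝ (closure Ω)) (hc : IsGraphChart Ω x r ν L G)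
    {w : Space d → Space d} (hw : ContDiffOn ℝ 1 w (closure Ω)) (hn : NormalTraceEq Ω w 0)
    {ρ : ℝ} (hρ : ρ < r) (hsupp : tsupport w ⊆ Metric.closedBall x ρ) :
    ∫ y in Ω, divg Ω w y = 0 := by
  have hGc := hc.lipschitz.continuous
  have hdint : IntegrableOn (divg Ω w) Ω := hΩ.integrableOn (continuousOn_divg hu hw)
  have hlim : Tendsto (fun n : ℕ => ∫ y in Ω, layerCutoff G n y * divg Ω w y) atTop
      (𝓝 (∫ y in Ω, divg Ω w y)) := by
    refine tendsto_integral_of_dominated_convergence (fun y => ‖divg Ω w y‖) ?_ hdint.norm ?_ ?_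
    · intro n
      obtain ⟨C, hC⟩ := exists_lipschitzWith_layerCutoff hc.lipschitz n
      exact hC.continuous.aestronglyMeasurable.mul hdint.aestronglyMeasurable
    · intro n
      refine Eventually.of_forall fun y => ?_
      rw [norm_mul, Real.norm_of_nonneg layerCutoff_nonneg]
      exact mul_le_of_le_one_left (norm_nonneg _) layerCutoff_le_one
    · filter_upwards [ae_restrict_mem hΩ.isOpen.measurableSet] with y hyΩ
      by_cases hyw : y ∈ tsupport w
      · have hGy : 0 < G y := (hc.mem_iff y (Metric.closedBall_subset_ball hρ (hsupp hyw))).1 hyΩ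
        refine tendsto_const_nhds.congr' ?_
        obtain ⟨m, hm⟩ := exists_nat_gt (2 / G y)
        filter_upwards [eventually_ge_atTop m] with n hnm
        have h1 : (m : ℝ) ≤ n := by exact_mod_cast hnm
        rw [layerCutoff_eq_one, one_mul]
        rw [div_lt_iff₀ hGy] at hm
        nlinarith
      · have h2 : divg Ω w y = 0 := by
          refine Finset.sum_eq_zero fun i _ => ?_
          have he : (fun z => w z i) =ᶠ[𝓝 y] fun _ => 0 := by
            filter_upwards [notMem_tsupport_iff_eventuallyEq.1 hyw] with z hz
            simp [hz]
          rw [pd_eq_fderiv hΩ.isOpen i _ hyΩ, he.fderiv_eq]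
          simp
        simp [h2]
  have h2n : Tendsto (fun n : ℕ => 2 / (n : ℝ)) atTop (𝓝 0) :=
    tendsto_const_div_atTop_nhds_zero_nat 2
  have hzero : Tendsto (fun n : ℕ => ∫ y in Ω, layerCutoff G n y * divg Ω w y) atTop (𝓝 0) := by
    rw [Metric.tendsto_nhds]
    intro ε hε
    set M := (L : ℝ) * volume.real (Metric.closedBall x (ρ + 1)) with hM
    have hM0 : 0 ≤ M := by positivity
    -- Dividing by `M + 1` avoids the case `M = 0` and makes the final bound strictly less than `ε`.
    have hη : 0 < ε / (M + 1) := by positivity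
    obtain ⟨δ, hδ, hmod⟩ := Metric.uniformContinuousOn_iff.1
      (hΩ.isCompact_closure.uniformContinuousOn_of_continuous hw.continuousOn) _ hη
    filter_upwards [eventually_gt_atTop 0, h2n.eventually_lt_const hδ,
      h2n.eventually_lt_const (sub_pos.2 hρ)] with n hn0 hnδ hnr
    have := hc.abs_setIntegral_layerCutoff_mul_divg_le hΩ.isOpen hw hn hn0 (by linarith) hsupp
      hη.le (fun a ha b hb hab => by
        rw [← dist_eq_norm]
        exact (hmod a ha b hb (hab.trans_lt hnδ)).le)
    rw [Real.dist_eq, sub_zero]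
    refine this.trans_lt ?_
    have e : (L : ℝ) * (ε / (M + 1)) * volume.real (Metric.closedBall x (ρ + 1))
        = ε * (M / (M + 1)) := by rw [hM]; ring
    rw [e]
    refine mul_lt_of_lt_one_right hε ?_
    rw [div_lt_one (by positivity)]
    linarith
  exact tendsto_nhds_unique hlim hzero

end IsGraphChart

open scoped Manifold ContDiff in
/-- **Divergence theorem** for fields with vanishing normal trace. -/
theorem IsBoundedLipschitzDomain.setIntegral_divg_eq_zero {d : ℕ} [NeZero d] {Ω : Set (Space d)}
    (hΩ : IsBoundedLipschitzDomain Ω) {v : Space d → Space d}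
    (hv : ContDiffOn ℝ 1 v (closure Ω)) (hn : NormalTraceEq Ω v 0) :
    ∫ y in Ω, divg Ω v y = 0 := by
  have hu := hΩ.uniqueDiffOn
  choose! r ν L G hc using fun (x : Space d) (hx : x ∈ closure Ω) => hΩ.exists_chart hx
  -- Half radii keep the closed supports of the localised fields strictly inside the charts.
  -- Multiplication by a scalar function preserves the zero normal trace.
  obtain ⟨t, htΩ, ht⟩ := hΩ.isCompact_closure.elim_nhds_subcover
    (fun x => Metric.ball x (r x / 2))
    fun x hx => Metric.ball_mem_nhds x (half_pos (hc x hx).radius_pos)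
  obtain ⟨ψ, hψ⟩ := SmoothPartitionOfUnity.exists_isSubordinate 𝓘(ℝ, Space d)
    (isClosed_closure (s := Ω)) (fun x : t => Metric.ball (x : Space d) (r x / 2))
    (fun x => Metric.isOpen_ball) (fun y hy => by
      obtain ⟨x, hx, hyx⟩ := mem_iUnion₂.1 (ht hy)
      exact mem_iUnion.2 ⟨⟨x, hx⟩, hyx⟩)
  have hψc : ∀ x : t, ContDiff ℝ 1 (ψ x) := fun x =>
    (ψ x).contMDiff.contDiff.of_le (by exact_mod_cast le_top)
  have hwc : ∀ x ∈ (Finset.univ : Finset t),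
      ContDiffOn ℝ 1 (fun y => ψ x y • v y) (closure Ω) := fun x _ =>
    (hψc x).contDiffOn.smul hv
  have hsum : ∀ y ∈ closure Ω, divg Ω v y = ∑ x : t, divg Ω (fun y => ψ x y • v y) y := by
    intro y hy
    rw [← divg_sum hu _ hwc hy]
    refine divg_congr (fun z hz => ?_) hy
    have h1 := ψ.sum_eq_one hz
    rw [finsum_eq_sum_of_fintype] at h1
    rw [← Finset.sum_smul, h1, one_smul]
  rw [setIntegral_congr_fun hΩ.isOpen.measurableSet fun y hy => hsum y (subset_closure hy),
    integral_finsetSum _ fun x hx => hΩ.integrableOn (continuousOn_divg hu (hwc x hx))]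
  refine Finset.sum_eq_zero fun x hx => ?_
  have hcx := hc x (htΩ x x.2)
  refine hcx.setIntegral_divg_eq_zero hΩ hu (hwc x hx) ?_ (half_lt_self hcx.radius_pos) ?_
  · intro y hy N hN
    rw [real_inner_smul_right, hn y hy N hN]
    simp
  · exact (tsupport_smul_subset_left _ _).trans ((hψ x).trans Metric.ball_subset_closedBall)

/-! ### Green's identity and viscous work -/

section IntegrationByParts

variable {d : ℕ} {Ω : Set (Space d)}

/-- Green's identity with homogeneous Neumann data. -/
theorem IsBoundedLipschitzDomain.integral_mul_lap [NeZero d] (hΩ : IsBoundedLipschitzDomain Ω)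
    {f g : Space d → ℝ} (hf : ContDiffOn ℝ 1 f (closure Ω)) (hg : ContDiffOn ℝ 2 g (closure Ω))
    (hn : NormalTraceEq Ω (grad Ω g) 0) :
    ∫ x in Ω, f x * lap Ω g x = -∫ x in Ω, inner ℝ (grad Ω f x) (grad Ω g x) := by
  have hu := hΩ.uniqueDiffOn
  have hgg : ContDiffOn ℝ 1 (grad Ω g) (closure Ω) := contDiffOn_grad hu hg (by norm_num)
  have hgf : ContDiffOn ℝ 0 (grad Ω f) (closure Ω) := contDiffOn_grad hu hf (by norm_num)
  have h0 := hΩ.setIntegral_divg_eq_zero (v := fun y => f y • grad Ω g y) (hf.smul hgg) (by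
    intro x hx N hN
    rw [real_inner_smul_right, hn x hx N hN]
    simp)
  have h1 : ∀ x ∈ Ω, divg Ω (fun y => f y • grad Ω g y) x
      = f x * lap Ω g x + inner ℝ (grad Ω f x) (grad Ω g x) := fun x hx =>
    divg_smul hu hf hgg (subset_closure hx)
  rw [setIntegral_congr_fun hΩ.isOpen.measurableSet h1, integral_add] at h0
  · linarith
  · exact hΩ.integrableOn (hf.continuousOn.mul (continuousOn_divg hu hgg))
  · exact hΩ.integrableOn (hgf.continuousOn.inner hgg.continuousOn)

theorem continuousOn_gradDotStrain (hu : UniqueDiffOn ℝ (closure Ω))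
    {M : Space d → ℝ} {u : Space d → Space d} (hM : ContDiffOn ℝ 1 M (closure Ω))
    (hu1 : ContDiffOn ℝ 1 u (closure Ω)) : ContinuousOn (gradDotStrain Ω M u) (closure Ω) := by
  refine (contDiffOn_euclidean (n := 0).2 fun i => contDiffOn_zero.2 ?_).continuousOn
  change ContinuousOn (fun y => ∑ j, pd Ω j M y *
    (pd Ω j (fun z => u z i) y + pd Ω i (fun z => u z j) y)) (closure Ω)
  have hc : ∀ {f : Space d → ℝ}, ContDiffOn ℝ 1 f (closure Ω) →
      ∀ j, ContinuousOn (pd Ω j f) (closure Ω) := fun hf j =>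
    (contDiffOn_pd (m := 0) hu hf (by norm_num) j).continuousOn
  exact continuousOn_finsetSum _ fun j _ => (hc hM j).mul
    ((hc (contDiffOn_comp hu1 i) j).add (hc (contDiffOn_comp hu1 j) i))

/-- For a divergence free field, `∇ · 𝒟(u) = ∇² u`. -/
theorem sum_pd_strain [NeZero d] (hΩ : IsBoundedLipschitzDomain Ω) {u : Space d → Space d}
    (hu2 : ContDiffOn ℝ 2 u (closure Ω)) (hdiv : ∀ x ∈ Ω, divg Ω u x = 0) (i : Fin d)
    {x : Space d} (hx : x ∈ Ω) :
    ∑ j, pd Ω j (fun y => strain Ω u y j i) x = vlap Ω u x i := by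
  have hu := hΩ.uniqueDiffOn
  have hp : ∀ j k : Fin d, ContDiffOn ℝ 1 (pd Ω j fun z => u z k) (closure Ω) := fun j k =>
    contDiffOn_pd hu (contDiffOn_comp hu2 k) (by norm_num) j
  have h1 : ∀ j, pd Ω j (fun y => strain Ω u y j i) x
      = pd Ω j (pd Ω j fun z => u z i) x + pd Ω i (pd Ω j fun z => u z j) x := by
    intro j
    rw [← pd_pd_comm hΩ.isOpen (contDiffOn_comp hu2 j) j i hx]
    exact pd_add hu (hp j i) (hp i j) j (subset_closure hx)
  -- The transposed half of the strain contributes `∂_i (∇ · u)`, which is zero because `∇ · u`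
  -- vanishes on a neighbourhood of `x`.
  have h2 : ∑ j, pd Ω i (pd Ω j fun z => u z j) x = 0 := by
    rw [← pd_sum hu Finset.univ (fun j _ => hp j j) i (subset_closure hx),
      pd_eq_fderiv hΩ.isOpen i _ hx]
    have he : (fun y => ∑ j, pd Ω j (fun z => u z j) y) =ᶠ[𝓝 x] fun _ => 0 := by
      filter_upwards [hΩ.isOpen.mem_nhds hx] with y hy using hdiv y hy
    rw [he.fderiv_eq]
    simp
  rw [Finset.sum_congr rfl fun j _ => h1 j, Finset.sum_add_distrib, h2, add_zero]
  rfl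

/-- A symmetric matrix pairs only with the symmetric part of `∇ u`, which is half the strain. -/
theorem sum_strain_mul_pd (u : Space d → Space d) (x : Space d) :
    ∑ j, ∑ i, strain Ω u x j i * pd Ω j (fun y => u y i) x = 1 / 2 * strainSq Ω u x := by
  have hs : ∀ i j, strain Ω u x i j = pd Ω i (fun y => u y j) x + pd Ω j (fun y => u y i) x :=
    fun i j => rfl
  have h1 : ∑ j, ∑ i, strain Ω u x j i * pd Ω j (fun y => u y i) x
      = ∑ j, ∑ i, strain Ω u x j i * pd Ω i (fun y => u y j) x := by
    rw [Finset.sum_comm]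
    refine Finset.sum_congr rfl fun j _ => Finset.sum_congr rfl fun i _ => ?_
    rw [hs, hs, add_comm]
  have h2 : strainSq Ω u x = ∑ j, ∑ i, strain Ω u x j i * pd Ω j (fun y => u y i) x
      + ∑ j, ∑ i, strain Ω u x j i * pd Ω i (fun y => u y j) x := by
    rw [strainSq, ← Finset.sum_add_distrib]
    refine Finset.sum_congr rfl fun j _ => ?_
    rw [← Finset.sum_add_distrib]
    refine Finset.sum_congr rfl fun i _ => ?_
    rw [hs]; ring
  rw [h2, ← h1]; ring

/-- The work of the viscous and pressure forces against a divergence free velocity that vanishes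
on the boundary is minus the viscous dissipation. -/
theorem IsBoundedLipschitzDomain.integral_inner_stress [NeZero d] (hΩ : IsBoundedLipschitzDomain Ω)
    {u : Space d → Space d} {M P : Space d → ℝ} (hu2 : ContDiffOn ℝ 2 u (closure Ω))
    (hM : ContDiffOn ℝ 1 M (closure Ω)) (hP : ContDiffOn ℝ 1 P (closure Ω))
    (hdiv : ∀ x ∈ Ω, divg Ω u x = 0) (h0 : ∀ x ∈ frontier Ω, u x = 0) :
    ∫ x in Ω, inner ℝ (gradDotStrain Ω M u x - grad Ω P x + M x • vlap Ω u x) (u x)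
      = -(1 / 2 * ∫ x in Ω, M x * strainSq Ω u x) := by
  have hu := hΩ.uniqueDiffOn
  have hu1 : ContDiffOn ℝ 1 u (closure Ω) := hu2.of_le (by norm_num)
  have hst : ∀ j i : Fin d, ContDiffOn ℝ 1 (fun y => strain Ω u y j i) (closure Ω) := fun j i =>
    (contDiffOn_pd hu (contDiffOn_comp hu2 i) (by norm_num) j).add
      (contDiffOn_pd hu (contDiffOn_comp hu2 j) (by norm_num) i)
  -- With `s = 𝒟(u) u`, the divergence of `M s - P u` is the stress work plus half of `M ‖𝒟(u)‖²`,
  -- and this field vanishes on the boundary along with `u`.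
  let s : Space d → Space d := fun y => WithLp.toLp 2 fun j => ∑ i, strain Ω u y j i * u y i
  have hs : ContDiffOn ℝ 1 s (closure Ω) := contDiffOn_euclidean.2 fun j => by
    change ContDiffOn ℝ 1 (fun y => ∑ i, strain Ω u y j i * u y i) (closure Ω)
    exact ContDiffOn.sum fun i _ => (hst j i).mul (contDiffOn_comp hu1 i)
  have hdivs : ∀ x ∈ Ω, divg Ω s x = inner ℝ (vlap Ω u x) (u x) + 1 / 2 * strainSq Ω u x := by
    intro x hx
    have h1 : ∀ j, pd Ω j (fun y => s y j) x
        = ∑ i, (strain Ω u x j i * pd Ω j (fun y => u y i) x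
          + pd Ω j (fun y => strain Ω u y j i) x * u x i) := by
      intro j
      have := pd_sum hu Finset.univ (f := fun i y => strain Ω u y j i * u y i)
        (fun i _ => (hst j i).mul (contDiffOn_comp hu1 i)) j (subset_closure hx)
      refine this.trans (Finset.sum_congr rfl fun i _ => ?_)
      exact pd_mul hu (hst j i) (contDiffOn_comp hu1 i) j (subset_closure hx)
    rw [divg, Finset.sum_congr rfl fun j _ => h1 j]
    simp only [Finset.sum_add_distrib]
    rw [sum_strain_mul_pd, add_comm, inner_eq_sum]
    congr 1
    rw [Finset.sum_comm]
    refine Finset.sum_congr rfl fun i _ => ?_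
    rw [← Finset.sum_mul, sum_pd_strain hΩ hu2 hdiv i hx]
  have hMs : ContDiffOn ℝ 1 (fun y => M y • s y) (closure Ω) := hM.smul hs
  have hPu : ContDiffOn ℝ 1 (fun y => P y • u y) (closure Ω) := hP.smul hu1
  have hz := hΩ.setIntegral_divg_eq_zero (v := fun y => M y • s y - P y • u y) (hMs.sub hPu) (by
    intro x hx N hN
    have hsx : s x = 0 := by ext j; simp [s, h0 x hx]
    simp [hsx, h0 x hx])
  have hpt : ∀ x ∈ Ω, divg Ω (fun y => M y • s y - P y • u y) x
      = inner ℝ (gradDotStrain Ω M u x - grad Ω P x + M x • vlap Ω u x) (u x)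
        + 1 / 2 * (M x * strainSq Ω u x) := by
    intro x hx
    have hx' := subset_closure hx
    have hin : inner ℝ (grad Ω M x) (s x) = inner ℝ (gradDotStrain Ω M u x) (u x) := by
      simp only [inner_eq_sum, s, grad, gradDotStrain, Finset.mul_sum, Finset.sum_mul]
      rw [Finset.sum_comm]
      exact Finset.sum_congr rfl fun i _ => Finset.sum_congr rfl fun j _ => by ring
    rw [divg_sub hu hMs hPu hx', divg_smul hu hM hs hx', divg_smul hu hP hu1 hx', hdivs x hx,
      hdiv x hx, hin, inner_add_left, inner_sub_left, real_inner_smul_left]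
    ring
  have hcds := continuousOn_gradDotStrain hu hM hu1
  have hcP : ContinuousOn (grad Ω P) (closure Ω) :=
    (contDiffOn_grad (m := 0) hu hP (by norm_num)).continuousOn
  have hcl : ContinuousOn (vlap Ω u) (closure Ω) :=
    (contDiffOn_vlap (l := 0) (m := 1) hu hu2 (by norm_num) (by norm_num)).continuousOn
  have hcs : ContinuousOn (strainSq Ω u) (closure Ω) :=
    continuousOn_finsetSum _ fun i _ => continuousOn_finsetSum _ fun j _ =>
      (hst i j).continuousOn.pow 2
  rw [setIntegral_congr_fun hΩ.isOpen.measurableSet hpt, integral_add, integral_const_mul] at hz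
  · linarith
  · exact hΩ.integrableOn
      (((hcds.sub hcP).add (hM.continuousOn.smul hcl)).inner hu1.continuousOn)
  · exact (hΩ.integrableOn (hM.continuousOn.mul hcs)).const_mul _

end IntegrationByParts

/-! ### Backward differentiation formulas -/

section BackwardDifferentiation

theorem BDF.succ_mem_stencil (J : BDF) (n : ℕ) : n + 1 ∈ J.stencil n := by
  cases J <;> simp [BDF.stencil, BDF.order]; omega

theorem BDF.self_mem_stencil (J : BDF) (n : ℕ) : n ∈ J.stencil n := by
  cases J <;> simp [BDF.stencil, BDF.order]

theorem BDF.pred_mem_stencil {n : ℕ} (hn : BDF.two.order ≤ n + 1) : n - 1 ∈ BDF.two.stencil n := by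
  simp only [BDF.order] at hn
  simp only [BDF.stencil, BDF.order, mem_ofPred_eq]
  omega

theorem BDF.contDiffOn_star {d : ℕ} {F : Type} [NormedAddCommGroup F] [NormedSpace ℝ F]
    (J : BDF) {n : ℕ} (hn : J.order ≤ n + 1) {χ : ℕ → Space d → F} {s : Set (Space d)}
    {m : WithTop ℕ∞} (h : ∀ k ∈ J.stencil n, ContDiffOn ℝ m (χ k) s) :
    ContDiffOn ℝ m (J.star χ n) s := by
  cases J with
  | one => exact h n (BDF.self_mem_stencil _ n)
  | two =>
    exact (contDiffOn_const.smul (h n (BDF.self_mem_stencil _ n))).sub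
      (h (n - 1) (BDF.pred_mem_stencil hn))

theorem BDF.contDiffOn_diffQuot {d : ℕ} {F : Type} [NormedAddCommGroup F] [NormedSpace ℝ F]
    (J : BDF) (τ : ℝ) {n : ℕ} (hn : J.order ≤ n + 1) {χ : ℕ → Space d → F} {s : Set (Space d)}
    {m : WithTop ℕ∞} (h : ∀ k ∈ J.stencil n, ContDiffOn ℝ m (χ k) s) :
    ContDiffOn ℝ m (J.diffQuot τ χ n) s := by
  have h1 := h _ (J.succ_mem_stencil n)
  have h0 := h _ (J.self_mem_stencil n)
  cases J with
  | one => exact contDiffOn_const.smul ((contDiffOn_const.smul h1).sub h0)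
  | two =>
    exact contDiffOn_const.smul ((contDiffOn_const.smul h1).sub
      ((contDiffOn_const.smul h0).sub
        (contDiffOn_const.smul (h (n - 1) (BDF.pred_mem_stencil hn)))))

variable {d : ℕ} {Ω : Set (Space d)}

theorem BDF.grad_star (J : BDF) (hu : UniqueDiffOn ℝ (closure Ω)) {n : ℕ} (hn : J.order ≤ n + 1)
    {φ : ℕ → Space d → ℝ} (h : ∀ k ∈ J.stencil n, ContDiffOn ℝ 1 (φ k) (closure Ω))
    {x : Space d} (hx : x ∈ closure Ω) :
    grad Ω (J.star φ n) x = J.star (fun k => grad Ω (φ k)) n x := by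
  have h0 := h _ (J.self_mem_stencil n)
  cases J with
  | one => rfl
  | two =>
    refine (grad_sub hu (f := fun y => 2 * φ n y) (contDiffOn_const.mul h0)
      (h _ (BDF.pred_mem_stencil hn)) hx).trans ?_
    rw [grad_const_mul hu 2 h0 hx]
    rfl

theorem BDF.grad_diffQuot (J : BDF) (hu : UniqueDiffOn ℝ (closure Ω)) (τ : ℝ) {n : ℕ}
    (hn : J.order ≤ n + 1) {φ : ℕ → Space d → ℝ}
    (h : ∀ k ∈ J.stencil n, ContDiffOn ℝ 1 (φ k) (closure Ω)) {x : Space d}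
    (hx : x ∈ closure Ω) :
    grad Ω (J.diffQuot τ φ n) x = J.diffQuot τ (fun k => grad Ω (φ k)) n x := by
  have h1 := h _ (J.succ_mem_stencil n)
  have h0 := h _ (J.self_mem_stencil n)
  cases J with
  | one =>
    -- The factor 1 is `γ₀`, kept so that `diffQuot` matches by unfolding.
    have h2 : ContDiffOn ℝ 1 (fun y => 1 * φ (n + 1) y) (closure Ω) := contDiffOn_const.mul h1
    refine (grad_const_mul hu τ⁻¹ (f := fun y => 1 * φ (n + 1) y - φ n y) (h2.sub h0) hx).trans ?_
    rw [grad_sub hu h2 h0 hx, grad_const_mul hu 1 h1 hx]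
    rfl
  | two =>
    have hp := h _ (BDF.pred_mem_stencil hn)
    have h2 : ContDiffOn ℝ 1 (fun y => 3 / 2 * φ (n + 1) y) (closure Ω) := contDiffOn_const.mul h1
    have h3 : ContDiffOn ℝ 1 (fun y => 2 * φ n y) (closure Ω) := contDiffOn_const.mul h0
    have h4 : ContDiffOn ℝ 1 (fun y => 1 / 2 * φ (n - 1) y) (closure Ω) := contDiffOn_const.mul hp
    refine (grad_const_mul hu τ⁻¹
      (f := fun y => 3 / 2 * φ (n + 1) y - (2 * φ n y - 1 / 2 * φ (n - 1) y))
      (h2.sub (h3.sub h4)) hx).trans ?_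
    rw [grad_sub hu h2 (h3.sub h4) hx, grad_sub hu h3 h4 hx, grad_const_mul hu _ h1 hx,
      grad_const_mul hu _ h0 hx, grad_const_mul hu _ hp hx]
    rfl

/-- The chemical potential contains `h(φ*)`, so its flux through the boundary involves the Neumann
data of the earlier levels. -/
theorem BDF.normalTrace_star (J : BDF) {n : ℕ} (hn : J.order ≤ n + 1)
    {v : ℕ → Space d → Space d} (h : ∀ k ∈ J.stencil n, NormalTraceEq Ω (v k) 0) :
    NormalTraceEq Ω (J.star v n) 0 := by
  intro x hx N hN
  have h0 := h _ (J.self_mem_stencil n) x hx N hN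
  cases J with
  | one => exact h0
  | two =>
    have hp := h _ (BDF.pred_mem_stencil hn) x hx N hN
    simp only [BDF.star, Pi.sub_apply, Pi.smul_apply]
    rw [inner_sub_right, real_inner_smul_right, h0, hp]
    simp

theorem inner_bdf_one {E : Type*} [NormedAddCommGroup E] [InnerProductSpace ℝ E] (a b : E) :
    inner ℝ a (a - b) = 1 / 2 * (‖a‖ ^ 2 - ‖b‖ ^ 2 + ‖a - b‖ ^ 2) := by
  rw [norm_sub_sq_real, inner_sub_right, real_inner_self_eq_norm_sq]
  ring

/-- This is the G-stability of BDF2: a telescoping quadratic form in consecutive pairs plus the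
square of the second difference. It fixes the weights in the discrete energy. -/
theorem inner_bdf_two {E : Type*} [NormedAddCommGroup E] [InnerProductSpace ℝ E] (a b c : E) :
    inner ℝ a ((3 / 2 : ℝ) • a - ((2 : ℝ) • b - (1 / 2 : ℝ) • c))
      = 1 / 4 * (‖a‖ ^ 2 - ‖b‖ ^ 2 + ‖(2 : ℝ) • a - b‖ ^ 2 - ‖(2 : ℝ) • b - c‖ ^ 2
        + ‖a - ((2 : ℝ) • b - c)‖ ^ 2) := by
  simp only [norm_sub_sq_real, inner_sub_right, real_inner_smul_right, real_inner_smul_left,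
    real_inner_self_eq_norm_sq, norm_smul, mul_pow]
  norm_num
  ring

end BackwardDifferentiation

/-! ### Balances of the scheme -/

theorem Params.hasDerivAt_h (p : Params) (s : ℝ) :
    HasDerivAt p.h (p.lam / p.η ^ 2 * (3 * s ^ 2 - 1)) s := by
  have h1 := (((hasDerivAt_id s).pow 3).sub (hasDerivAt_id s)).const_mul (p.lam / p.η ^ 2)
  refine h1.congr_deriv ?_
  simp

theorem Params.contDiff_h (p : Params) : ContDiff ℝ 2 p.h := by
  unfold Params.h
  fun_prop

namespace Iterates

variable {d : ℕ} {s : Iterates d} {Ω : Set (Space d)} {p : Params} {J : BDF} {n : ℕ}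

/-- Here the `C⁴` regularity of the phase field is spent: one Laplacian is already in the chemical
potential and another is applied to it in the phase equation. -/
theorem contDiffOn_chem (hu : UniqueDiffOn ℝ (closure Ω)) (hn : J.order ≤ n + 1)
    (hreg : s.IsClassical Ω J n) : ContDiffOn ℝ 2 (s.chem Ω p J n) (closure Ω) := by
  have hφ : ∀ k ∈ J.stencil n, ContDiffOn ℝ 2 (s.φ k) (closure Ω) := fun k hk =>
    (hreg.φ k hk).of_le (by norm_num)
  have hlap : ContDiffOn ℝ 2 (lap Ω (s.φ (n + 1))) (closure Ω) :=
    contDiffOn_lap (m := 3) hu (hreg.φ _ (J.succ_mem_stencil n)) (by norm_num) (by norm_num)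
  have hstar := J.contDiffOn_star hn hφ
  exact ((contDiffOn_const.mul hlap).add
    (contDiffOn_const.mul ((hφ _ (J.succ_mem_stencil n)).sub hstar))).add
    (contDiffOn_const.mul (p.contDiff_h.comp_contDiffOn hstar))

/-- By the chain rule the gradient combines `∇(∇² φ)`, `∇ φ` and `∇ φ*`, each with zero normal
component. -/
theorem normalTrace_grad_chem (hu : UniqueDiffOn ℝ (closure Ω))
    (hn : J.order ≤ n + 1) (hreg : s.IsClassical Ω J n)
    (hφn : ∀ k ∈ J.stencil n, NormalTraceEq Ω (grad Ω (s.φ k)) 0)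
    (hlapn : NormalTraceEq Ω (grad Ω (lap Ω (s.φ (n + 1)))) 0) :
    NormalTraceEq Ω (grad Ω (s.chem Ω p J n)) 0 := by
  intro x hx N hN
  have hx' : x ∈ closure Ω := frontier_subset_closure hx
  have hφ : ∀ k ∈ J.stencil n, ContDiffOn ℝ 1 (s.φ k) (closure Ω) := fun k hk =>
    (hreg.φ k hk).of_le (by norm_num)
  have hφ1 := hφ _ (J.succ_mem_stencil n)
  have hlap : ContDiffOn ℝ 1 (lap Ω (s.φ (n + 1))) (closure Ω) :=
    contDiffOn_lap (m := 2) hu (hreg.φ _ (J.succ_mem_stencil n)) (by norm_num) (by norm_num)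
  have hstar := J.contDiffOn_star hn hφ
  have hh : ContDiffOn ℝ 1 (fun y => p.h (J.star s.φ n y)) (closure Ω) :=
    (p.contDiff_h.of_le (by norm_num)).comp_contDiffOn hstar
  have hA : ContDiffOn ℝ 1 (fun y => -p.lam * lap Ω (s.φ (n + 1)) y) (closure Ω) :=
    contDiffOn_const.mul hlap
  have hB : ContDiffOn ℝ 1 (fun y => p.S * (s.φ (n + 1) y - J.star s.φ n y)) (closure Ω) :=
    contDiffOn_const.mul (hφ1.sub hstar)
  have hC : ContDiffOn ℝ 1 (fun y => s.xi Ω p n * p.h (J.star s.φ n y)) (closure Ω) :=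
    contDiffOn_const.mul hh
  have e : grad Ω (s.chem Ω p J n) x = -p.lam • grad Ω (lap Ω (s.φ (n + 1))) x
      + p.S • (grad Ω (s.φ (n + 1)) x - J.star (fun k => grad Ω (s.φ k)) n x)
      + s.xi Ω p n • (p.lam / p.η ^ 2 * (3 * (J.star s.φ n x) ^ 2 - 1))
        • J.star (fun k => grad Ω (s.φ k)) n x := by
    refine (grad_add hu (hA.add hB) hC hx').trans ?_
    rw [grad_add hu hA hB hx', grad_const_mul hu _ hlap hx',
      grad_const_mul hu _ (hφ1.sub hstar) hx', grad_const_mul hu _ hh hx',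
      grad_sub hu hφ1 hstar hx', grad_comp hu hstar (p.hasDerivAt_h _) hx',
      J.grad_star hu hn hφ hx']
  have h1 := hφn _ (J.succ_mem_stencil n) x hx N hN
  have h2 := J.normalTrace_star hn hφn x hx N hN
  have h3 := hlapn x hx N hN
  simp only [Pi.zero_apply] at h1 h2 h3
  rw [e]
  simp only [inner_add_right, inner_sub_right, real_inner_smul_right, h1, h2, h3]
  simp

/-- The balance of the momentum equation tested with the velocity. -/
theorem momentum_balance [NeZero d] (hΩ : IsBoundedLipschitzDomain Ω) {D : Data d}
    (hn : J.order ≤ n + 1) (hreg : s.IsClassical Ω J n) (hstep : s.SchemeStep Ω p J n D)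
    (hf : ∀ x ∈ Ω, D.f (n + 1) x = 0) (hw : ∀ x ∈ frontier Ω, D.w (n + 1) x = 0) :
    (∫ x in Ω, s.rhoBar p n x * inner ℝ (J.diffQuot p.Δt s.u n x) (s.u (n + 1) x))
        - (∫ x in Ω, s.chem Ω p J n x * inner ℝ (s.u (n + 1) x) (grad Ω (s.φbar (n + 1)) x))
        + s.xi Ω p n *
          (∫ x in Ω, s.rhoBar p n x * inner ℝ (s.NL Ω p J n x) (s.u (n + 1) x))
        + (∫ x in Ω, inner ℝ
            (gradDotStrain Ω (s.muBar p n) (s.u (n + 1)) x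
              + (s.rhoBar p n x / p.ρ₀ - 1) • grad Ω (s.P (n + 1)) x
              + (s.muBar p n x - p.νm * s.rhoBar p n x) • vlap Ω (s.u (n + 1)) x)
            (s.u (n + 1) x))
      = -(1 / 2 * ∫ x in Ω, s.muBar p n x * strainSq Ω (s.u (n + 1)) x) := by
  have hu := hΩ.uniqueDiffOn
  have hu2 := hreg.u _ (J.succ_mem_stencil n)
  have hu1 : ContDiffOn ℝ 1 (s.u (n + 1)) (closure Ω) := hu2.of_le (by norm_num)
  have hP1 := hreg.P _ (J.succ_mem_stencil n)
  have hφb : ContDiffOn ℝ 1 (s.φbar (n + 1)) (closure Ω) := hreg.φbar.of_le (by norm_num)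
  have hmu : ContDiffOn ℝ 1 (s.muBar p n) (closure Ω) :=
    contDiffOn_const.add (contDiffOn_const.mul hφb)
  have hrho : ContinuousOn (s.rhoBar p n) (closure Ω) :=
    (contDiffOn_const.add (contDiffOn_const.mul hφb)).continuousOn
  have hrho' : ContinuousOn (fun x => s.rhoBar p n x / p.ρ₀) (closure Ω) := hrho.div_const _
  have hmuc := hmu.continuousOn
  have hcu := hu1.continuousOn
  have hcdu := (J.contDiffOn_diffQuot p.Δt hn hreg.u).continuousOn
  have hcC := (contDiffOn_chem (p := p) hu hn hreg).continuousOn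
  have hcgφ : ContinuousOn (grad Ω (s.φbar (n + 1))) (closure Ω) :=
    (contDiffOn_grad (m := 0) hu hφb (by norm_num)).continuousOn
  have hcP : ContinuousOn (grad Ω (s.P (n + 1))) (closure Ω) :=
    (contDiffOn_grad (m := 0) hu hP1 (by norm_num)).continuousOn
  have hcl : ContinuousOn (vlap Ω (s.u (n + 1))) (closure Ω) :=
    (contDiffOn_vlap (l := 0) (m := 1) hu hu2 (by norm_num) (by norm_num)).continuousOn
  have hcs := continuousOn_gradDotStrain hu hmu hu1
  rw [← hΩ.integral_inner_stress hu2 hmu hP1 hstep.incompressible fun x hx => by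
    rw [hstep.velocity_bc x hx, hw x hx]]
  -- The momentum equation eliminates `ξ ρ̄ 𝒩` altogether, so the explicit form of `𝒩` plays no
  -- role.
  have hNL : s.xi Ω p n *
      (∫ x in Ω, s.rhoBar p n x * inner ℝ (s.NL Ω p J n x) (s.u (n + 1) x))
      = ∫ x in Ω, inner ℝ (-(s.rhoBar p n x / p.ρ₀) • grad Ω (s.P (n + 1)) x
        + (p.νm * s.rhoBar p n x) • vlap Ω (s.u (n + 1)) x
        + s.chem Ω p J n x • grad Ω (s.φbar (n + 1)) x
        - s.rhoBar p n x • J.diffQuot p.Δt s.u n x) (s.u (n + 1) x) := by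
    rw [← integral_const_mul]
    refine setIntegral_congr_fun hΩ.isOpen.measurableSet fun x hx => ?_
    have h1 := hstep.momentum x hx
    rw [hf x hx, add_zero] at h1
    rw [← h1, add_sub_cancel_left, real_inner_smul_left]
    ring
  rw [hNL, ← integral_sub, ← integral_add, ← integral_add]
  -- The inertial, capillary and `νm` terms cancel pointwise, and the two pressure terms add up to
  -- `-∇P`.
  · refine setIntegral_congr_fun hΩ.isOpen.measurableSet fun x _ => ?_
    simp only [inner_add_left, inner_sub_left, real_inner_smul_left]
    rw [real_inner_comm (grad Ω (s.φbar (n + 1)) x) (s.u (n + 1) x)]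
    ring
  all_goals exact hΩ.integrableOn (by fun_prop)

/-- The balance of the phase field equation tested with the chemical potential. -/
theorem phase_balance [NeZero d] (hΩ : IsBoundedLipschitzDomain Ω) {D : Data d}
    (hn : J.order ≤ n + 1) (hreg : s.IsClassical Ω J n) (hstep : s.SchemeStep Ω p J n D)
    (hg : ∀ x ∈ Ω, D.g (n + 1) x = 0)
    (hφn : ∀ k ∈ J.stencil n, NormalTraceEq Ω (grad Ω (s.φ k)) 0)
    (hlapn : NormalTraceEq Ω (grad Ω (lap Ω (s.φ (n + 1)))) 0) :
    s.xi Ω p n *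
        (∫ x in Ω, s.chem Ω p J n x * inner ℝ (J.star s.u n x) (grad Ω (J.star s.φ n) x))
      + s.xi Ω p n * (∫ x in Ω, p.h (J.star s.φ n x) * J.diffQuot p.Δt s.φ n x)
      + p.S * (∫ x in Ω, (s.φ (n + 1) x - J.star s.φ n x) * J.diffQuot p.Δt s.φ n x)
      + p.lam * (∫ x in Ω, inner ℝ (grad Ω (s.φ (n + 1)) x)
          (J.diffQuot p.Δt (fun k => grad Ω (s.φ k)) n x))
      = -∫ x in Ω, p.m * ‖grad Ω (s.chem Ω p J n) x‖ ^ 2 := by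
  have hu := hΩ.uniqueDiffOn
  have hφ : ∀ k ∈ J.stencil n, ContDiffOn ℝ 1 (s.φ k) (closure Ω) := fun k hk =>
    (hreg.φ k hk).of_le (by norm_num)
  have hC2 := contDiffOn_chem (p := p) hu hn hreg
  have hC1 : ContDiffOn ℝ 1 (s.chem Ω p J n) (closure Ω) := hC2.of_le (by norm_num)
  have hδ := J.contDiffOn_diffQuot p.Δt hn hφ
  have hstar := J.contDiffOn_star hn hφ
  have hφ2 : ContDiffOn ℝ 2 (s.φ (n + 1)) (closure Ω) :=
    (hreg.φ _ (J.succ_mem_stencil n)).of_le (by norm_num)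
  have hlapc : ContinuousOn (lap Ω (s.φ (n + 1))) (closure Ω) :=
    (contDiffOn_lap (l := 0) (m := 1) hu hφ2 (by norm_num) (by norm_num)).continuousOn
  have hlapC : ContinuousOn (lap Ω (s.chem Ω p J n)) (closure Ω) :=
    (contDiffOn_lap (l := 0) (m := 1) hu hC2 (by norm_num) (by norm_num)).continuousOn
  have hhc : ContinuousOn (fun x => p.h (J.star s.φ n x)) (closure Ω) :=
    p.contDiff_h.continuous.comp_continuousOn hstar.continuousOn
  have hδc := hδ.continuousOn
  have hstarc := hstar.continuousOn
  have hφc := hφ2.continuousOn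
  have hCc := hC1.continuousOn
  -- `g1` turns the mobility term into dissipation; `g2` moves the Laplacian of the new phase field
  -- onto `δφ`, producing `∇φ · δ∇φ`.
  have g1 := hΩ.integral_mul_lap hC1 hC2
    (normalTrace_grad_chem hu hn hreg hφn hlapn)
  have g2 := hΩ.integral_mul_lap hδ hφ2 (hφn _ (J.succ_mem_stencil n))
  have e2 : ∫ x in Ω, inner ℝ (grad Ω (s.φ (n + 1)) x)
      (J.diffQuot p.Δt (fun k => grad Ω (s.φ k)) n x)
      = -∫ x in Ω, J.diffQuot p.Δt s.φ n x * lap Ω (s.φ (n + 1)) x := by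
    rw [g2, neg_neg]
    refine setIntegral_congr_fun hΩ.isOpen.measurableSet fun x hx => ?_
    rw [J.grad_diffQuot hu p.Δt hn hφ (subset_closure hx), real_inner_comm]
  have e1 : ∫ x in Ω, p.m * ‖grad Ω (s.chem Ω p J n) x‖ ^ 2
      = -(p.m * ∫ x in Ω, s.chem Ω p J n x * lap Ω (s.chem Ω p J n) x) := by
    rw [g1, integral_const_mul]
    simp only [real_inner_self_eq_norm_sq]
    ring
  have e3 : s.xi Ω p n *
      (∫ x in Ω, s.chem Ω p J n x * inner ℝ (J.star s.u n x) (grad Ω (J.star s.φ n) x))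
      = ∫ x in Ω, (p.m * (s.chem Ω p J n x * lap Ω (s.chem Ω p J n) x)
        - s.chem Ω p J n x * J.diffQuot p.Δt s.φ n x) := by
    rw [← integral_const_mul]
    refine setIntegral_congr_fun hΩ.isOpen.measurableSet fun x hx => ?_
    have h1 := hstep.phase x hx
    rw [hg x hx, add_zero] at h1
    linear_combination (s.chem Ω p J n x) * h1
  have e4 : ∫ x in Ω, s.chem Ω p J n x * J.diffQuot p.Δt s.φ n x
      = -p.lam * (∫ x in Ω, J.diffQuot p.Δt s.φ n x * lap Ω (s.φ (n + 1)) x)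
        + p.S * (∫ x in Ω, (s.φ (n + 1) x - J.star s.φ n x) * J.diffQuot p.Δt s.φ n x)
        + s.xi Ω p n * (∫ x in Ω, p.h (J.star s.φ n x) * J.diffQuot p.Δt s.φ n x) := by
    rw [← integral_const_mul, ← integral_const_mul, ← integral_const_mul, ← integral_add,
      ← integral_add]
    · refine setIntegral_congr_fun hΩ.isOpen.measurableSet fun x _ => ?_
      simp only [chem]
      ring
    all_goals exact hΩ.integrableOn (by fun_prop)
  rw [integral_sub (hΩ.integrableOn (by fun_prop)) (hΩ.integrableOn (by fun_prop)),
    integral_const_mul, e4] at e3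
  rw [e1, e2, e3]
  ring

theorem discreteDissipation_nonneg : 0 ≤ s.discreteDissipation Ω p J n := by
  have hS := p.S_nonneg
  have hτ := p.Δt_pos
  have hl := p.lam_pos
  have h1 : ∀ f : Space d → ℝ, 0 ≤ sqNorm Ω f := fun f => integral_nonneg fun x => sq_nonneg _
  have h2 : ∀ v : Space d → Space d, 0 ≤ vsqNorm Ω v := fun v => integral_nonneg fun x => sq_nonneg _
  cases J with
  | one =>
    have := h1 (s.φ (n + 1) - s.φ n)
    have := h2 (grad Ω (s.φ (n + 1)) - grad Ω (s.φ n))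
    simp only [discreteDissipation]
    positivity
  | two =>
    have := h1 (s.φ (n + 1) - BDF.two.star s.φ n)
    have := h2 (grad Ω (s.φ (n + 1)) - grad Ω (BDF.two.star s.φ n))
    simp only [discreteDissipation]
    positivity

/-- The algebraic energy identity of the backward differentiation formulas. -/
theorem discreteEnergy_sub_add_dissipation (hΩ : IsBoundedLipschitzDomain Ω)
    (hu : UniqueDiffOn ℝ (closure Ω)) (hn : J.order ≤ n + 1)
    (hφ : ∀ k ∈ J.stencil n, ContDiffOn ℝ 1 (s.φ k) (closure Ω)) :
    s.discreteEnergy Ω p J (n + 1) - s.discreteEnergy Ω p J n + s.discreteDissipation Ω p J n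
      = 2 * s.R (n + 1) * J.diffQuot p.Δt s.R n
        + p.S * (∫ x in Ω, (s.φ (n + 1) x - J.star s.φ n x) * J.diffQuot p.Δt s.φ n x)
        + p.lam * (∫ x in Ω, inner ℝ (grad Ω (s.φ (n + 1)) x)
            (J.diffQuot p.Δt (fun k => grad Ω (s.φ k)) n x)) := by
  have hτ := p.Δt_pos.ne'
  have hgc : ∀ k ∈ J.stencil n, ContinuousOn (grad Ω (s.φ k)) (closure Ω) := fun k hk =>
    (contDiffOn_grad (m := 0) hu (hφ k hk) (by norm_num)).continuousOn
  have h1 := (hφ _ (J.succ_mem_stencil n)).continuousOn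
  have h0 := (hφ _ (J.self_mem_stencil n)).continuousOn
  have g1 := hgc _ (J.succ_mem_stencil n)
  have g0 := hgc _ (J.self_mem_stencil n)
  cases J with
  | one =>
    -- At first order `φ - φ*` is `Δt δφ`, so the stabilisation is pure dissipation and leaves no
    -- trace in the energy.
    have e1 : ∫ x in Ω, (s.φ (n + 1) x - BDF.one.star s.φ n x) * BDF.one.diffQuot p.Δt s.φ n x
        = p.Δt⁻¹ * sqNorm Ω (s.φ (n + 1) - s.φ n) := by
      rw [sqNorm, ← integral_const_mul]
      refine integral_congr_ae (Eventually.of_forall fun x => ?_)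
      simp only [BDF.star, BDF.diffQuot, BDF.gamma0, BDF.hat, Pi.smul_apply, Pi.sub_apply,
        smul_eq_mul]
      ring
    have e2 : ∫ x in Ω, inner ℝ (grad Ω (s.φ (n + 1)) x)
        (BDF.one.diffQuot p.Δt (fun k => grad Ω (s.φ k)) n x)
        = p.Δt⁻¹ * (1 / 2 * (vsqNorm Ω (grad Ω (s.φ (n + 1))) - vsqNorm Ω (grad Ω (s.φ n))
          + vsqNorm Ω (grad Ω (s.φ (n + 1)) - grad Ω (s.φ n)))) := by
      simp only [vsqNorm]
      rw [← integral_sub, ← integral_add, ← integral_const_mul, ← integral_const_mul]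
      · refine integral_congr_ae (Eventually.of_forall fun x => ?_)
        simp only [BDF.diffQuot, BDF.gamma0, BDF.hat, Pi.smul_apply, Pi.sub_apply, one_smul]
        rw [real_inner_smul_right, inner_bdf_one]
      · exact hΩ.integrableOn ((g1.norm.pow 2).sub (g0.norm.pow 2))
      · exact hΩ.integrableOn ((g1.sub g0).norm.pow 2)
      · exact hΩ.integrableOn (g1.norm.pow 2)
      · exact hΩ.integrableOn (g0.norm.pow 2)
    rw [e1, e2]
    simp only [discreteEnergy, discreteDissipation, BDF.diffQuot, BDF.gamma0, BDF.hat, smul_eq_mul,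
      sq_abs]
    field_simp
    ring
  | two =>
    have hp := (hφ _ (BDF.pred_mem_stencil hn)).continuousOn
    have gp := hgc _ (BDF.pred_mem_stencil hn)
    -- With increments `a = φ^{n+1} - φ^n` and `b = φ^n - φ^{n-1}` this is `(a - b)(3a - b)/2 = (a²
    -- - b²)/2 + (a - b)²`.
    have e1 : ∫ x in Ω, (s.φ (n + 1) x - BDF.two.star s.φ n x) * BDF.two.diffQuot p.Δt s.φ n x
        = p.Δt⁻¹ * (1 / 2 * (sqNorm Ω (s.φ (n + 1) - s.φ n) - sqNorm Ω (s.φ n - s.φ (n - 1)))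
          + sqNorm Ω (s.φ (n + 1) - BDF.two.star s.φ n)) := by
      simp only [sqNorm]
      rw [← integral_sub, ← integral_const_mul, ← integral_add, ← integral_const_mul]
      · refine integral_congr_ae (Eventually.of_forall fun x => ?_)
        simp only [BDF.star, BDF.diffQuot, BDF.gamma0, BDF.hat, Pi.smul_apply, Pi.sub_apply,
          smul_eq_mul]
        ring
      · exact (hΩ.integrableOn (((h1.sub h0).pow 2).sub ((h0.sub hp).pow 2))).const_mul _
      · exact hΩ.integrableOn ((h1.sub ((h0.const_smul (2 : ℝ)).sub hp)).pow 2)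
      · exact hΩ.integrableOn ((h1.sub h0).pow 2)
      · exact hΩ.integrableOn ((h0.sub hp).pow 2)
    have s1 : ∀ x ∈ Ω, grad Ω ((2 : ℝ) • s.φ (n + 1) - s.φ n) x
        = (2 : ℝ) • grad Ω (s.φ (n + 1)) x - grad Ω (s.φ n) x := fun x hx => by
      refine (grad_sub hu (f := fun y => 2 * s.φ (n + 1) y)
        (contDiffOn_const.mul (hφ _ (BDF.two.succ_mem_stencil n)))
        (hφ _ (BDF.two.self_mem_stencil n)) (subset_closure hx)).trans ?_
      rw [grad_const_mul hu 2 (hφ _ (BDF.two.succ_mem_stencil n)) (subset_closure hx)]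
    have s0 : ∀ x ∈ Ω, grad Ω (BDF.two.star s.φ n) x
        = (2 : ℝ) • grad Ω (s.φ n) x - grad Ω (s.φ (n - 1)) x := fun x hx =>
      BDF.two.grad_star hu hn hφ (subset_closure hx)
    have v1 : vsqNorm Ω (grad Ω ((2 : ℝ) • s.φ (n + 1) - s.φ n))
        = ∫ x in Ω, ‖(2 : ℝ) • grad Ω (s.φ (n + 1)) x - grad Ω (s.φ n) x‖ ^ 2 :=
      setIntegral_congr_fun hΩ.isOpen.measurableSet fun x hx => by simp only [s1 x hx]
    have v0 : vsqNorm Ω (grad Ω ((2 : ℝ) • s.φ n - s.φ (n - 1)))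
        = ∫ x in Ω, ‖(2 : ℝ) • grad Ω (s.φ n) x - grad Ω (s.φ (n - 1)) x‖ ^ 2 :=
      setIntegral_congr_fun hΩ.isOpen.measurableSet fun x hx => by
        simp only [← s0 x hx, BDF.star]
    have vd : vsqNorm Ω (grad Ω (s.φ (n + 1)) - grad Ω (BDF.two.star s.φ n))
        = ∫ x in Ω, ‖grad Ω (s.φ (n + 1)) x
          - ((2 : ℝ) • grad Ω (s.φ n) x - grad Ω (s.φ (n - 1)) x)‖ ^ 2 :=
      setIntegral_congr_fun hΩ.isOpen.measurableSet fun x hx => by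
        simp only [Pi.sub_apply, s0 x hx]
    have e2 : ∫ x in Ω, inner ℝ (grad Ω (s.φ (n + 1)) x)
        (BDF.two.diffQuot p.Δt (fun k => grad Ω (s.φ k)) n x)
        = p.Δt⁻¹ * (1 / 4 * (vsqNorm Ω (grad Ω (s.φ (n + 1))) - vsqNorm Ω (grad Ω (s.φ n))
          + vsqNorm Ω (grad Ω ((2 : ℝ) • s.φ (n + 1) - s.φ n))
          - vsqNorm Ω (grad Ω ((2 : ℝ) • s.φ n - s.φ (n - 1)))
          + vsqNorm Ω (grad Ω (s.φ (n + 1)) - grad Ω (BDF.two.star s.φ n)))) := by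
      rw [v1, v0, vd]
      simp only [vsqNorm]
      rw [← integral_sub, ← integral_add, ← integral_sub, ← integral_add, ← integral_const_mul,
        ← integral_const_mul]
      · refine integral_congr_ae (Eventually.of_forall fun x => ?_)
        simp only [BDF.diffQuot, BDF.gamma0, BDF.hat, Pi.smul_apply, Pi.sub_apply]
        rw [real_inner_smul_right, inner_bdf_two]
      all_goals exact hΩ.integrableOn (by fun_prop)
    rw [e1, e2]
    -- `add_tsub_cancel_right` identifies the previous level of the energy at `n + 1` with `n`; the
    -- identity for `R` is left to `ring`.
    simp only [discreteEnergy, discreteDissipation, BDF.diffQuot, BDF.gamma0, BDF.hat, BDF.star,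
      smul_eq_mul, sq_abs, add_tsub_cancel_right]
    field_simp
    ring

end Iterates

theorem surfaceIntegral_eq_zero {d : ℕ} {Ω : Set (Space d)} {F : Space d → ℝ}
    (h : ∀ x ∈ frontier Ω, F x = 0) : surfaceIntegral Ω F = 0 :=
  setIntegral_eq_zero_of_forall_eq_zero h

end TwoPhase

end

theorem theorem1 (d : ℕ) (hd : d = 2 ∨ d = 3)
    (Ω : Set (TwoPhase.Space d)) (hΩ : TwoPhase.IsBoundedLipschitzDomain Ω)
    (p : TwoPhase.Params) (J : TwoPhase.BDF)
    (D : TwoPhase.Data d) (s : TwoPhase.Iterates d)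
    (n : ℕ) (hn : J.order ≤ n + 1)
    (hreg : s.IsClassical Ω J n)
    (hstep : s.SchemeStep Ω p J n D)
    (hprev : ∀ k ∈ J.stencil n,
      TwoPhase.NormalTraceEq Ω (TwoPhase.grad Ω (s.φ k)) (D.da k))
    (hf : ∀ x ∈ Ω, D.f (n + 1) x = 0)
    (hg : ∀ x ∈ Ω, D.g (n + 1) x = 0)
    (hw : ∀ x ∈ frontier Ω, D.w (n + 1) x = 0)
    (hda : ∀ k ∈ J.stencil n, ∀ x ∈ frontier Ω, D.da k x = 0)
    (hdb : ∀ x ∈ frontier Ω, D.db (n + 1) x = 0) :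
    s.discreteEnergy Ω p J (n + 1) - s.discreteEnergy Ω p J n
        = -s.discreteDissipation Ω p J n
          - 1 / 2 * (∫ x in Ω, s.muBar p n x * TwoPhase.strainSq Ω (s.u (n + 1)) x)
          - (∫ x in Ω, p.m * ‖TwoPhase.grad Ω (s.chem Ω p J n) x‖ ^ 2)
      ∧ 0 ≤ s.discreteDissipation Ω p J n
      ∧ ((∀ x ∈ Ω, 0 ≤ s.muBar p n x) →
          s.discreteEnergy Ω p J (n + 1) ≤ s.discreteEnergy Ω p J n) := by 
  have : NeZero d := ⟨by omega⟩
  have hφ : ∀ k ∈ J.stencil n, ContDiffOn ℝ 1 (s.φ k) (closure Ω) := fun k hk =>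
    (hreg.φ k hk).of_le (by norm_num)
  have hφn : ∀ k ∈ J.stencil n, TwoPhase.NormalTraceEq Ω (TwoPhase.grad Ω (s.φ k)) 0 :=
    fun k hk x hx N hN => (hprev k hk x hx N hN).trans (hda k hk x hx)
  have hlapn : TwoPhase.NormalTraceEq Ω
      (TwoPhase.grad Ω (TwoPhase.lap Ω (s.φ (n + 1)))) 0 :=
    fun x hx N hN => (hstep.lap_phase_bc x hx N hN).trans (hdb x hx)
  have hu0 : ∀ x ∈ frontier Ω, s.u (n + 1) x = 0 := fun x hx => by
    rw [hstep.velocity_bc x hx, hw x hx]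
  have hbdf := TwoPhase.Iterates.discreteEnergy_sub_add_dissipation (p := p) hΩ hΩ.uniqueDiffOn
    hn hφ
  have hmom := TwoPhase.Iterates.momentum_balance hΩ hn hreg hstep hf hw
  have hph := TwoPhase.Iterates.phase_balance hΩ hn hreg hstep hg hφn hlapn
  have haux := hstep.auxiliary
  -- Both surface integrands carry the factor `‖u‖²`, which is zero on the boundary.
  rw [TwoPhase.surfaceIntegral_eq_zero fun x hx => by simp [hu0 x hx],
    TwoPhase.surfaceIntegral_eq_zero fun x hx => by simp [hu0 x hx]] at haux
  have hD : 0 ≤ s.discreteDissipation Ω p J n := TwoPhase.Iterates.discreteDissipation_nonneg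
  have hE : s.discreteEnergy Ω p J (n + 1) - s.discreteEnergy Ω p J n
      = -s.discreteDissipation Ω p J n
        - 1 / 2 * (∫ x in Ω, s.muBar p n x * TwoPhase.strainSq Ω (s.u (n + 1)) x)
        - (∫ x in Ω, p.m * ‖TwoPhase.grad Ω (s.chem Ω p J n) x‖ ^ 2) := by
    -- The right side of `haux` is the sum of the left side of `hmom` and the two `ξ` terms of
    -- `hph`; substituting into `hbdf` leaves the two dissipation integrals.
    linarith
  refine ⟨hE, hD, fun hmu => ?_⟩
  have h1 : 0 ≤ ∫ x in Ω, s.muBar p n x * TwoPhase.strainSq Ω (s.u (n + 1)) x :=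
    setIntegral_nonneg hΩ.isOpen.measurableSet fun x hx => mul_nonneg (hmu x hx)
      (Finset.sum_nonneg fun i _ => Finset.sum_nonneg fun j _ => sq_nonneg _)
  have h2 : 0 ≤ ∫ x in Ω, p.m * ‖TwoPhase.grad Ω (s.chem Ω p J n) x‖ ^ 2 :=
    integral_nonneg fun x => mul_nonneg p.m_pos.le (sq_nonneg _)
  linarith
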